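/- **Theorem 3.2 (Rényi unlearning guarantee of PNSGD unlearning, fixed mini-batch sequence).** *Setting.* Let $R>0$, $\mathcal{C}_R=\{x\in\mathbb{R}^d:\|x\|\le R\}$ (Euclidean norm), let $\Pi_{\mathcal{C}_R}$ be the orthogonal projection onto $\mathcal{C}_R$, let $\mathcal{X}$ be a set of data points and $f(\cdot\,;\mathbf{d}):\mathbb{R}^d\to\mathbb{R}$, $\mathbf{d}\in\mathcal{X}$, a family of losses. Let $b\ge 1$ divide $n$, and let $\mathcal{B}=(\mathcal{B}^0,\dots,\mathcal{B}^{n/b-1})$ be a fixed ordered partition of $\{1,\dots,n\}$ into mini-batches of size $b$. Let $\eta,\sigma>0$ and let $\nu_0$ be a probability measure supported on $\mathcal{C}_R$. One epoch of projected noisy SGD on a dataset $\mathcal{D}=(\mathbf{d}_1,\dots,\mathbf{d}_n)\in\mathcal{X}^n$ consists of the updates, for $j=0,\dots,n/b-1$ in this order, $$x\ \longmapsto\ \Pi_{\mathcal{C}_R}\Big(x-\frac{\eta}{b}\sum_{i\in\mathcal{B}^j}\nabla f(x;\mathbf{d}_i)+\sqrt{2\eta\sigma^2}\,W\Big),\qquad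 W\sim\mathcal{N}(0,I_d),$$ with fresh independent noise in each update. The learning algorithm $\mathcal{M}(\mathcal{D})$ runs $T\ge1$ epochs on $\mathcal{D}$ from a starting point drawn from $\nu_0$; the unlearning algorithm $\mathcal{U}(y,\mathcal{D},\mathcal{D}')$ runs $K\ge1$ epochs on $\mathcal{D}'$ from the starting point $y$. For $\alpha>1$ and probability measures $\mu,\nu$ let $D_\alpha(\mu\|\nu)=\frac1{\alpha-1}\log\mathbb{E}_{x\sim\nu}\big[\big(\frac{d\mu}{d\nu}(x)\big)^\alpha\big]$ if $\mu\ll\nu$ and $D_\alpha(\mu\|\nu)=\infty$ otherwise, and let $d_\alpha(\mu,\nu)=\max(D_\alpha(\mu\|\nu),D_\alpha(\nu\|\mu))$. The pair $(\mathcal{M},\mathcal{U})$ satisfies $(\alpha,\varepsilon)$-Rényi unlearning if, for all $\mathcal{D},\mathcal{D}'\in\mathcal{X}^n$ such that $\mathcal{D}'$ is obtained from $\mathcal{D}$ by replacing one data point, $d_\alpha(\rho,\nu')\le\varepsilon$, where $\rho$ is the law of $\mathcal{U}(\mathcal{M}(\mathcal{D}),\mathcal{D},\mathcal{D}')$ and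 $\nu'$ is the law of $\mathcal{M}(\mathcal{D}')$. *Statement.* Let $L,m>0$ and $M\in\mathbb{R}$. Assume that for every $\mathbf{d}\in\mathcal{X}$ the loss $f=f(\cdot\,;\mathbf{d})$ is differentiable at every point of $\mathcal{C}_R$ and that, for all $x,y\in\mathcal{C}_R$, $$\|\nabla f(x)-\nabla f(y)\|\le L\|x-y\|,\qquad |f(x)-f(y)|\le M\|x-y\|,\qquad \langle x-y,\nabla f(x)-\nabla f(y)\rangle\ge m\|x-y\|^2 .$$ Let $\eta\le 1/L$ and $c=1-\eta m$. Then for every $\alpha>1$ the pair $(\mathcal{M},\mathcal{U})$ satisfies $(\alpha,\varepsilon)$-Rényi unlearning with $$\varepsilon=\frac{\alpha-1/2}{\alpha-1}\big(\varepsilon_1(2\alpha)+\varepsilon_2(2\alpha)\big),$$ where, for $a>0$, $$\varepsilon_1(a)=\frac{a(2R)^2}{2\eta\sigma^2}c^{2Tn/b},\qquad \varepsilon_2(a)=\frac{a Z_{\mathcal{B}}^2}{2\eta\sigma^2}c^{2Kn/b},\qquad Z_{\mathcal{B}}=2Rc^{Tn/b}+\min\Big(\frac{1-c^{Tn/b}}{1-c^{n/b}}\cdot\frac{2\eta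 M}{b},\,2R\Big).$$ -/

import Mathlib

open MeasureTheory ProbabilityTheory
open scoped ENNReal

namespace SGLU

/-- The parameter space `ℝ^d` with the Euclidean norm. -/
abbrev Param (d : ℕ) : Type := EuclideanSpace ℝ (Fin d)

/-! ### Regularity of a loss on a set of parameters -/

/-- `f` is differentiable at every point of `s` and its gradient is `L`-Lipschitz on `s`. -/
def SmoothOn {d : ℕ} (L : ℝ) (s : Set (Param d)) (f : Param d → ℝ) : Prop :=
  (∀ x ∈ s, DifferentiableAt ℝ f x) ∧
    ∀ x ∈ s, ∀ y ∈ s, ‖gradient f x - gradient f y‖ ≤ L * ‖x - y‖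

/-- `f` is `M`-Lipschitz on `s`. -/
def LipschitzOn {d : ℕ} (M : ℝ) (s : Set (Param d)) (f : Param d → ℝ) : Prop :=
  ∀ x ∈ s, ∀ y ∈ s, |f x - f y| ≤ M * ‖x - y‖

/-- `f` is `m`-strongly convex on `s`, in the gradient (strong monotonicity) form. -/
def StronglyConvexOn {d : ℕ} (m : ℝ) (s : Set (Param d)) (f : Param d → ℝ) : Prop :=
  ∀ x ∈ s, ∀ y ∈ s, m * ‖x - y‖ ^ 2 ≤ inner ℝ (x - y) (gradient f x - gradient f y)

/-! ### Rényi divergence and Rényi unlearning -/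

/-- The Rényi divergence `D_α(μ‖ν) = (α - 1)⁻¹ log E_{x ∼ ν} (dμ/dν)^α` of order `α > 1`, with
values in the extended reals; it is `⊤` when `μ` is not absolutely continuous w.r.t. `ν`. -/
noncomputable def renyiDiv {E : Type*} [MeasurableSpace E] (α : ℝ) (μ ν : Measure E) : EReal :=
  open Classical in
  if μ ≪ ν then
    (((α - 1)⁻¹ : ℝ) : EReal) * ENNReal.log (∫⁻ x, (μ.rnDeriv ν x) ^ α ∂ν)
  else ⊤

/-- The Rényi difference, the larger one of the two Rényi divergences. -/
noncomputable def renyiDiff {E : Type*} [MeasurableSpace E] (α : ℝ) (μ ν : Measure E) : EReal :=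
  max (renyiDiv α μ ν) (renyiDiv α ν μ)

/-- `D'` is obtained from `D` by replacing one data point. -/
def Adjacent {𝒳 : Type*} {n : ℕ} (D D' : Fin n → 𝒳) : Prop :=
  ∃ i : Fin n, ∀ j : Fin n, j ≠ i → D j = D' j

/-- `(α, ε)`-Rényi unlearning. The randomized learning algorithm `M` gives the law `M D` of the
learned parameter; the randomized unlearning algorithm `U` gives, for the two datasets and the
current parameter `x`, the law `U D D' x` of its output. Hence `(M D).bind (U D D')` is the law of
`U(M(D), D, D')`. -/
def RenyiUnlearning {𝒳 E : Type*} [MeasurableSpace E] {n : ℕ} (M : (Fin n → 𝒳) → Measure E)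
    (U : (Fin n → 𝒳) → (Fin n → 𝒳) → Kernel E E) (α ε : ℝ) : Prop :=
  ∀ D D' : Fin n → 𝒳, Adjacent D D' →
    renyiDiff α ((M D).bind (U D D')) (M D') ≤ (ε : EReal)

/-! ### Projected noisy SGD with cyclic mini-batches -/

/-- A mini-batch sequence: an ordered partition of the `n` indices into `n / b` batches of
size `b`. -/
structure MiniBatches (n b : ℕ) where
  batch : Fin (n / b) → Finset (Fin n)
  card_batch : ∀ j, (batch j).card = b
  existsUnique_mem : ∀ i, ∃! j, i ∈ batch j

/-- The orthogonal projection of `ℝ^d` onto the closed ball `C_R` (for `R ≥ 0`). -/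
noncomputable def projBall {d : ℕ} (R : ℝ) (x : Param d) : Param d :=
  open Classical in if ‖x‖ ≤ R then x else (R / ‖x‖) • x

/-- The projection lands in the ball. -/
theorem projBall_mem {d : ℕ} {R : ℝ} (hR : 0 ≤ R) (x : Param d) :
    projBall R x ∈ Metric.closedBall (0 : Param d) R := by
  unfold projBall
  split_ifs with h
  · simpa using h
  · have hx : 0 < ‖x‖ := hR.trans_lt (not_le.mp h)
    simp [norm_smul, abs_of_nonneg hR, hx.ne']

/-- The projection of `x` is a nearest point of the ball. -/
theorem dist_projBall_le {d : ℕ} {R : ℝ} (hR : 0 ≤ R) (x y : Param d)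
    (hy : y ∈ Metric.closedBall (0 : Param d) R) : dist x (projBall R x) ≤ dist x y := by
  have hy' : ‖y‖ ≤ R := by simpa using hy
  unfold projBall
  split_ifs with h
  · simp
  · have h' := not_le.mp h
    have hx : 0 < ‖x‖ := hR.trans_lt h'
    have e : x - (R / ‖x‖) • x = (1 - R / ‖x‖) • x := by rw [sub_smul, one_smul]
    have h1 : 0 ≤ 1 - R / ‖x‖ := by
      rw [sub_nonneg, div_le_one hx]; exact h'.le
    rw [dist_eq_norm, dist_eq_norm, e, norm_smul, Real.norm_of_nonneg h1, sub_mul,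
      div_mul_cancel₀ _ hx.ne', one_mul]
    linarith [norm_sub_norm_le x y]

theorem measurable_projBall {d : ℕ} (R : ℝ) : Measurable (projBall (d := d) R) := by
  unfold projBall
  exact Measurable.ite (measurableSet_le measurable_norm measurable_const) measurable_id
    ((measurable_const.div measurable_norm).smul measurable_id)

/-- The mini-batch gradient `g(x, β) = (1/b) ∑_{i ∈ β} ∇f(x; D i)`. -/
noncomputable def batchGrad {𝒳 : Type*} {d n : ℕ} (f : Param d → 𝒳 → ℝ) (b : ℕ)
    (D : Fin n → 𝒳) (β : Finset (Fin n)) (x : Param d) : Param d :=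
  (1 / (b : ℝ)) • ∑ i ∈ β, gradient (fun z => f z (D i)) x

/-- One update `Π_{C_R}(x - η g(x, β) + √(2ησ²) w)` with the noise value `w`. -/
noncomputable def pnsgdUpdate {𝒳 : Type*} {d n : ℕ} (f : Param d → 𝒳 → ℝ) (R η σ : ℝ) (b : ℕ)
    (D : Fin n → 𝒳) (β : Finset (Fin n)) (x w : Param d) : Param d :=
  projBall R (x - η • batchGrad f b D β x + √(2 * η * σ ^ 2) • w)

theorem measurable_pnsgdUpdate {𝒳 : Type*} {d n : ℕ} (f : Param d → 𝒳 → ℝ) (R η σ : ℝ) (b : ℕ)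
    (D : Fin n → 𝒳) (β : Finset (Fin n)) :
    Measurable (fun p : Param d × Param d => pnsgdUpdate f R η σ b D β p.1 p.2) := by
  have hg : ∀ h : Param d → ℝ, Measurable (gradient h) := fun h =>
    (InnerProductSpace.toDual ℝ (Param d)).symm.continuous.measurable.comp (measurable_fderiv ℝ h)
  have hb : Measurable (batchGrad f b D β) :=
    (Finset.measurable_sum β fun i _ => hg fun z => f z (D i)).const_smul (1 / (b : ℝ))
  exact (measurable_projBall R).comp
    ((measurable_fst.sub ((hb.comp measurable_fst).const_smul η)).add
      (measurable_snd.const_smul (√(2 * η * σ ^ 2))))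

/-- The transition kernel of one iteration: from `x`, the law of
`Π_{C_R}(x - η g(x, β) + √(2ησ²) W)` with fresh noise `W ∼ N(0, I_d)`. -/
noncomputable def stepKernel {𝒳 : Type*} {d n : ℕ} (f : Param d → 𝒳 → ℝ) (R η σ : ℝ) (b : ℕ)
    (D : Fin n → 𝒳) (β : Finset (Fin n)) : Kernel (Param d) (Param d) where
  toFun x := (stdGaussian (Param d)).map (pnsgdUpdate f R η σ b D β x)
  measurable' := by
    have h := measurable_pnsgdUpdate f R η σ b D β
    have e : (fun x => (stdGaussian (Param d)).map (pnsgdUpdate f R η σ b D β x)) =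
        fun x => ((stdGaussian (Param d)).map (Prod.mk x)).map
          (fun p : Param d × Param d => pnsgdUpdate f R η σ b D β p.1 p.2) := by
      funext x
      rw [Measure.map_map h measurable_prodMk_left]
      rfl
    rw [e]
    exact (Measure.measurable_map _ h).comp Measurable.map_prodMk_left

/-- The transition kernel of one epoch: the iterations `j = 0, …, n/b - 1` in this order. -/
noncomputable def epochKernel {𝒳 : Type*} {d n b : ℕ} (f : Param d → 𝒳 → ℝ) (R η σ : ℝ)
    (B : MiniBatches n b) (D : Fin n → 𝒳) : Kernel (Param d) (Param d) :=
  (List.ofFn B.batch).foldl (fun κ β => (stepKernel f R η σ b D β).comp κ) Kernel.id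

/-- The transition kernel of `t` epochs of projected noisy SGD on the dataset `D`. -/
noncomputable def pnsgdKernel {𝒳 : Type*} {d n b : ℕ} (f : Param d → 𝒳 → ℝ) (R η σ : ℝ)
    (B : MiniBatches n b) (D : Fin n → 𝒳) : ℕ → Kernel (Param d) (Param d)
  | 0 => Kernel.id
  | t + 1 => (epochKernel f R η σ B D).comp (pnsgdKernel f R η σ B D t)

/-- The learning algorithm: the law of `x_T^0` on the dataset `D`, started from `x_0^0 ∼ ν₀`. -/
noncomputable def learn {𝒳 : Type*} {d n b : ℕ} (f : Param d → 𝒳 → ℝ) (R η σ : ℝ)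
    (B : MiniBatches n b) (ν₀ : Measure (Param d)) (T : ℕ) (D : Fin n → 𝒳) :
    Measure (Param d) :=
  ν₀.bind (pnsgdKernel f R η σ B D T)

/-- The unlearning algorithm: `K` epochs on the updated dataset `D'`, started from the current
parameter; the old dataset is not used. -/
noncomputable def unlearn {𝒳 : Type*} {d n b : ℕ} (f : Param d → 𝒳 → ℝ) (R η σ : ℝ)
    (B : MiniBatches n b) (K : ℕ) (_D D' : Fin n → 𝒳) : Kernel (Param d) (Param d) :=
  pnsgdKernel f R η σ B D' K

end SGLU

/-! The proof couples two noisy trajectories and pays for their distance once, at the last noise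
injection.

A mini-batch gradient step is `c`-Lipschitz on the ball (`norm_batchStep_sub_le`) and the projection
is nonexpansive, so running both chains with the same noise shrinks an almost sure distance by `c`
per iteration. Iterations that use different datasets add at most `2ηM/b`, and only when the
mini-batch contains the replaced index, hence at most once per epoch (`IsCoupled.run_epochs`). If
the drifts before the last noise are `δ` apart, the two output laws have Rényi divergence at most
`αδ²/(4ησ²)`: a random shift of the Gaussian is a Cameron–Martin tilt, and the projection is
post-processing (`renyiDiv_map_gaussian_le`, `IsCoupled.renyiDiff_run_le`).

Both final laws are images of points of the ball under common last epochs on `D'`. If `T ≤ K`, the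
last `T` epochs are common and the starting distance is at most `2R`. If `K ≤ T`, the last `K` are
common and are preceded by `T - K` epochs on `D` against `D'`; the distance then is a contracted
`2R` plus a geometric sum, capped at `2R`.

No triangle inequality for Rényi divergences is used: distances are added inside the coupling, and
`(x + y)² ≤ 2(x² + y²)` separates the two terms. The stated `ε`, with order `2α` and prefactor above
`1`, is larger than what this gives (`renyi_bound_le`). -/

namespace SGLU

/-! ### Rényi moments under push-forward -/

/-- Data processing: pushing `q • P` and `P` forward along `Ψ` does not increase the moments of the
density. -/
theorem lintegral_rnDeriv_map_rpow_le {Ω E : Type*} [MeasurableSpace Ω] [MeasurableSpace E]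
    (P : Measure Ω) [IsFiniteMeasure P] {q : Ω → ℝ≥0∞} (hq : Measurable q) {Ψ : Ω → E}
    (hΨ : Measurable Ψ) {α : ℝ} (hα : 1 < α) :
    ∫⁻ x, (((P.withDensity q).map Ψ).rnDeriv (P.map Ψ) x) ^ α ∂(P.map Ψ) ≤ ∫⁻ ω, q ω ^ α ∂P := by
  set ρ := (P.withDensity q).map Ψ with hρ
  set ν := P.map Ψ with hν
  set h := ρ.rnDeriv ν with hh
  have hmeas : Measurable h := Measure.measurable_rnDeriv _ _
  have hα0 : 0 < α := by linarith
  have hαm : 0 < α - 1 := by linarith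
  have hfin : IsFiniteMeasure ν := by rw [hν]; infer_instance
  -- Truncating the density at `k` makes its moment finite, so that a power of it can be cancelled
  -- after Hölder. Monotone convergence removes `k` at the end.
  have key : ∀ k : ℕ, ∫⁻ x, (min (h x) k) ^ α ∂ν ≤ ∫⁻ ω, q ω ^ α ∂P := by
    intro k
    set I := ∫⁻ x, (min (h x) k) ^ α ∂ν with hI
    have hg : Measurable fun x => min (h x) (k : ℝ≥0∞) := hmeas.min measurable_const
    have hItop : I ≠ ∞ := by
      refine ne_top_of_le_ne_top (b := ∫⁻ _, (k : ℝ≥0∞) ^ α ∂ν) ?_ ?_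
      · rw [lintegral_const]
        exact ENNReal.mul_ne_top (ENNReal.rpow_ne_top_of_nonneg hα0.le (ENNReal.natCast_ne_top k))
          (measure_ne_top _ _)
      · exact lintegral_mono fun x => ENNReal.rpow_le_rpow (min_le_right _ _) hα0.le
    have hle : I ≤ I ^ ((α - 1) / α) * (∫⁻ ω, q ω ^ α ∂P) ^ (1 / α) := by
      -- One factor `h` stays untruncated and turns `ν` into a measure below `ρ`. The integral then
      -- pulls back to `P`, where Hölder with exponents `α/(α-1)` and `α` reproduces `I`.
      calc I ≤ ∫⁻ x, h x * (min (h x) k) ^ (α - 1) ∂ν := by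
            refine lintegral_mono fun x => ?_
            have : (min (h x) (k : ℝ≥0∞)) ^ α
                = min (h x) (k : ℝ≥0∞) * (min (h x) (k : ℝ≥0∞)) ^ (α - 1) := by
              conv_lhs => rw [show α = 1 + (α - 1) by ring]
              rw [ENNReal.rpow_add_of_nonneg _ _ zero_le_one hαm.le, ENNReal.rpow_one]
            simp only [this]
            gcongr
            exact min_le_left _ _
        _ = ∫⁻ x, (min (h x) k) ^ (α - 1) ∂(ν.withDensity h) :=
            (lintegral_withDensity_eq_lintegral_mul _ hmeas (hg.pow_const _)).symm
        _ ≤ ∫⁻ x, (min (h x) k) ^ (α - 1) ∂ρ :=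
            lintegral_mono' (Measure.withDensity_rnDeriv_le _ _) le_rfl
        _ = ∫⁻ ω, q ω * (min (h (Ψ ω)) k) ^ (α - 1) ∂P := by
            rw [hρ, lintegral_map (hg.pow_const _) hΨ]
            exact lintegral_withDensity_eq_lintegral_mul _ hq ((hg.comp hΨ).pow_const _)
        _ = ∫⁻ ω, ((fun ω => (min (h (Ψ ω)) k) ^ (α - 1)) * q) ω ∂P := by
            refine lintegral_congr fun ω => ?_
            simp [mul_comm]
        _ ≤ (∫⁻ ω, ((min (h (Ψ ω)) k) ^ (α - 1)) ^ (α / (α - 1)) ∂P) ^ (1 / (α / (α - 1)))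
              * (∫⁻ ω, q ω ^ α ∂P) ^ (1 / α) := by
            refine ENNReal.lintegral_mul_le_Lp_mul_Lq P ?_ ((hg.comp hΨ).pow_const _).aemeasurable
              hq.aemeasurable
            exact (Real.HolderConjugate.conjExponent hα).symm
        _ = I ^ ((α - 1) / α) * (∫⁻ ω, q ω ^ α ∂P) ^ (1 / α) := by
            congr 2
            · rw [hI, hν, lintegral_map (hg.pow_const _) hΨ]
              refine lintegral_congr fun ω => ?_
              rw [← ENNReal.rpow_mul, mul_div_cancel₀ _ hαm.ne']
            · rw [one_div_div]
    by_cases hI0 : I = 0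
    · rw [hI0]; exact zero_le
    have hsplit : I = I ^ ((α - 1) / α) * I ^ (1 / α) := by
      rw [← ENNReal.rpow_add _ _ hI0 hItop, ← add_div, sub_add_cancel, div_self hα0.ne',
        ENNReal.rpow_one]
    have h0 : I ^ ((α - 1) / α) ≠ 0 := by simp [ENNReal.rpow_eq_zero_iff, hI0, hItop]
    have h1 : I ^ ((α - 1) / α) ≠ ∞ := ENNReal.rpow_ne_top_of_nonneg (by positivity) hItop
    have hle' : I ^ ((α - 1) / α) * I ^ (1 / α)
        ≤ I ^ ((α - 1) / α) * (∫⁻ ω, q ω ^ α ∂P) ^ (1 / α) := hsplit ▸ hle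
    rw [ENNReal.mul_le_mul_iff_right h0 h1] at hle'
    exact (ENNReal.rpow_le_rpow_iff (by positivity)).1 hle'
  have hlim : Filter.Tendsto (fun k : ℕ => ∫⁻ x, (min (h x) k) ^ α ∂ν) Filter.atTop
      (nhds (∫⁻ x, h x ^ α ∂ν)) := by
    refine lintegral_tendsto_of_tendsto_of_monotone
      (fun k => ((hmeas.min measurable_const).pow_const _).aemeasurable) ?_ ?_
    · refine Filter.Eventually.of_forall fun x i j hij => ?_
      have : (i : ℝ≥0∞) ≤ j := by exact_mod_cast hij
      exact ENNReal.rpow_le_rpow (min_le_min le_rfl this) hα0.le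
    · refine Filter.Eventually.of_forall fun x => ?_
      have h1 : Filter.Tendsto (fun k : ℕ => min (h x) (k : ℝ≥0∞)) Filter.atTop (nhds (h x)) := by
        simpa using (tendsto_const_nhds (x := h x)).min ENNReal.tendsto_nat_nhds_top
      exact (ENNReal.continuous_rpow_const.tendsto _).comp h1
  exact le_of_tendsto' hlim key

/-! ### Translation of the standard Gaussian -/

/-- On boxes the integrand is a product of functions of independent coordinates. This reduces the
Gaussian shift in `ℝ^d` to dimension one. -/
theorem pi_withDensity_prod {ι : Type*} [Fintype ι] {X : ι → Type*} [∀ i, MeasurableSpace (X i)]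
    (μ : ∀ i, Measure (X i)) [∀ i, IsProbabilityMeasure (μ i)] {g : ∀ i, X i → ℝ≥0∞}
    (hg : ∀ i, Measurable (g i)) [∀ i, SigmaFinite ((μ i).withDensity (g i))] :
    (Measure.pi μ).withDensity (fun x => ∏ i, g i (x i))
      = Measure.pi fun i => (μ i).withDensity (g i) := by
  symm
  refine Measure.pi_eq fun s hs => ?_
  have e : ∀ x : ∀ i, X i, (Set.univ.pi s).indicator (fun x => ∏ i, g i (x i)) x
      = ∏ i, (s i).indicator (g i) (x i) := by
    intro x
    by_cases hx : x ∈ Set.univ.pi s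
    · rw [Set.indicator_of_mem hx]
      exact Finset.prod_congr rfl fun i _ =>
        (Set.indicator_of_mem (hx i (Set.mem_univ i)) _).symm
    · rw [Set.indicator_of_notMem hx]
      obtain ⟨i, hi⟩ : ∃ i, x i ∉ s i := by simpa [Set.mem_pi] using hx
      exact (Finset.prod_eq_zero (Finset.mem_univ i) (Set.indicator_of_notMem hi _)).symm
  rw [withDensity_apply _ (MeasurableSet.univ_pi hs),
    ← lintegral_indicator (MeasurableSet.univ_pi hs), lintegral_congr e,
    lintegral_prod_eq_prod_lintegral_of_indepFun Finset.univ
      (fun i (x : ∀ i, X i) => (s i).indicator (g i) (x i))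
      (iIndepFun_pi fun i => ((hg i).indicator (hs i)).aemeasurable)
      (fun i => ((hg i).indicator (hs i)).comp (measurable_pi_apply i))]
  refine Finset.prod_congr rfl fun i _ => ?_
  rw [withDensity_apply _ (hs i), ← lintegral_indicator (hs i),
    ← (measurePreserving_eval μ i).map_eq,
    lintegral_map ((hg i).indicator (hs i)) (measurable_pi_apply i)]

theorem gaussianReal_withDensity_exp (v : ℝ) :
    (gaussianReal 0 1).withDensity (fun x => ENNReal.ofReal (Real.exp (v * x - v ^ 2 / 2)))
      = (gaussianReal 0 1).map (· + v) := by
  have hm : Measurable fun x : ℝ => ENNReal.ofReal (Real.exp (v * x - v ^ 2 / 2)) := by fun_prop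
  rw [gaussianReal_map_add_const, gaussianReal_of_var_ne_zero _ one_ne_zero,
    gaussianReal_of_var_ne_zero _ one_ne_zero, ← withDensity_mul _ (measurable_gaussianPDF _ _) hm]
  congr 1
  funext x
  simp only [Pi.mul_apply, gaussianPDF, gaussianPDFReal]
  rw [← ENNReal.ofReal_mul (by positivity), mul_assoc, ← Real.exp_add]
  congr 3
  simp only [NNReal.coe_one]
  ring

/-- The Cameron–Martin formula for the standard Gaussian. -/
theorem stdGaussian_withDensity_exp {d : ℕ} (v : Param d) :
    (stdGaussian (Param d)).withDensity
        (fun w => ENNReal.ofReal (Real.exp (inner ℝ v w - ‖v‖ ^ 2 / 2)))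
      = (stdGaussian (Param d)).map (· + v) := by
  have hm : Measurable (WithLp.toLp 2 : (Fin d → ℝ) → Param d) := by fun_prop
  rw [← map_pi_eq_stdGaussian, Measure.map_map (by fun_prop) hm]
  have hpi : (Measure.pi fun _ : Fin d => gaussianReal 0 1).withDensity
      (fun x => ∏ i, ENNReal.ofReal (Real.exp (v i * x i - v i ^ 2 / 2)))
      = (Measure.pi fun _ : Fin d => gaussianReal 0 1).map (fun x i => x i + v i) := by
    have : ∀ i, IsProbabilityMeasure ((gaussianReal 0 1).withDensity
        (fun x => ENNReal.ofReal (Real.exp (v i * x - v i ^ 2 / 2)))) := fun i => by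
      rw [gaussianReal_withDensity_exp]
      exact Measure.isProbabilityMeasure_map (by fun_prop)
    rw [pi_withDensity_prod (fun _ : Fin d => gaussianReal 0 1)
      (g := fun i x => ENNReal.ofReal (Real.exp (v i * x - v i ^ 2 / 2))) (fun i => by fun_prop)]
    simp_rw [gaussianReal_withDensity_exp]
    exact (Measure.pi_map_pi fun i => by fun_prop).symm
  have hcomp : ((· + v) ∘ (WithLp.toLp 2 : (Fin d → ℝ) → Param d))
      = WithLp.toLp 2 ∘ fun x i => x i + v i := by
    funext x
    ext i
    simp
  rw [hcomp, ← Measure.map_map hm (by fun_prop), ← hpi]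
  ext s hs
  have hq : Measurable fun w : Param d =>
      ENNReal.ofReal (Real.exp (inner ℝ v w - ‖v‖ ^ 2 / 2)) := by fun_prop
  rw [withDensity_apply _ hs, Measure.map_apply hm hs, withDensity_apply _ (hm hs),
    setLIntegral_map hs hq hm]
  refine lintegral_congr fun x => ?_
  rw [← ENNReal.ofReal_prod_of_nonneg fun i _ => (Real.exp_pos _).le, ← Real.exp_sum]
  congr 2
  rw [EuclideanSpace.norm_sq_eq, Finset.sum_div, PiLp.inner_apply, ← Finset.sum_sub_distrib]
  simp [mul_comm]

/-- The `α`-th power of the tilt by `v` is a constant times the tilt by `α • v`, which has total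
mass `1`. -/
theorem lintegral_exp_rpow_stdGaussian {d : ℕ} (v : Param d) (α : ℝ) :
    ∫⁻ w, ENNReal.ofReal (Real.exp (inner ℝ v w - ‖v‖ ^ 2 / 2)) ^ α ∂(stdGaussian (Param d))
      = ENNReal.ofReal (Real.exp (α * (α - 1) * ‖v‖ ^ 2 / 2)) := by
  have h1 : ∫⁻ w, ENNReal.ofReal (Real.exp (inner ℝ (α • v) w - ‖α • v‖ ^ 2 / 2))
      ∂(stdGaussian (Param d)) = 1 := by
    have := congrArg (fun μ => μ Set.univ) (stdGaussian_withDensity_exp (α • v))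
    simp only [withDensity_apply _ MeasurableSet.univ, Measure.restrict_univ] at this
    rw [this, Measure.map_apply (by fun_prop) MeasurableSet.univ]
    simp
  have h2 : ∀ w : Param d, ENNReal.ofReal (Real.exp (inner ℝ v w - ‖v‖ ^ 2 / 2)) ^ α
      = ENNReal.ofReal (Real.exp (α * (α - 1) * ‖v‖ ^ 2 / 2))
        * ENNReal.ofReal (Real.exp (inner ℝ (α • v) w - ‖α • v‖ ^ 2 / 2)) := by
    intro w
    rw [ENNReal.ofReal_rpow_of_pos (Real.exp_pos _), ← Real.exp_mul,
      ← ENNReal.ofReal_mul (Real.exp_pos _).le, ← Real.exp_add, real_inner_smul_left, norm_smul,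
      mul_pow, Real.norm_eq_abs, sq_abs]
    congr 2
    ring
  simp_rw [h2]
  rw [lintegral_const_mul' _ _ ENNReal.ofReal_ne_top, h1, mul_one]

/-! ### Rényi divergence of two coupled Gaussian mixtures -/

theorem renyiDiv_le_of_lintegral_le {E : Type*} [MeasurableSpace E] {α ε : ℝ} (hα : 1 < α)
    {μ ν : Measure E} (hac : μ ≪ ν)
    (h : ∫⁻ x, (μ.rnDeriv ν x) ^ α ∂ν ≤ ENNReal.ofReal (Real.exp ((α - 1) * ε))) :
    renyiDiv α μ ν ≤ ε := by
  rw [renyiDiv, if_pos hac]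
  have h1 : ENNReal.log (∫⁻ x, (μ.rnDeriv ν x) ^ α ∂ν) ≤ (((α - 1) * ε : ℝ) : EReal) := by
    refine (ENNReal.log_le_log h).trans_eq ?_
    rw [ENNReal.log_ofReal_of_pos (Real.exp_pos _), Real.log_exp]
  have hpos : 0 < α - 1 := by linarith
  calc (((α - 1)⁻¹ : ℝ) : EReal) * ENNReal.log (∫⁻ x, (μ.rnDeriv ν x) ^ α ∂ν)
      ≤ (((α - 1)⁻¹ : ℝ) : EReal) * (((α - 1) * ε : ℝ) : EReal) :=
        mul_le_mul_of_nonneg_left h1 (by exact_mod_cast (inv_pos.2 hpos).le)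
    _ = ε := by
        rw [← EReal.coe_mul, inv_mul_cancel_left₀ hpos.ne']

/-- Let `a` and `a'` be random points at distance at most `δ`, and let `W` be an independent
standard Gaussian. Then `Φ (a + s W)` and `Φ (a' + s W)` have Rényi divergence at most
`α δ² / (2 s²)`. -/
theorem renyiDiv_map_gaussian_le {Ω E : Type*} [MeasurableSpace Ω] [MeasurableSpace E] {d : ℕ}
    (γ : Measure Ω) [IsProbabilityMeasure γ] {a a' : Ω → Param d} (ha : Measurable a)
    (ha' : Measurable a') {s δ α : ℝ} (hs : 0 < s) (hα : 1 < α)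
    (hδ : ∀ᵐ ω ∂γ, ‖a ω - a' ω‖ ≤ δ) {Φ : Param d → E} (hΦ : Measurable Φ) :
    renyiDiv α ((γ.prod (stdGaussian (Param d))).map fun p => Φ (a p.1 + s • p.2))
      ((γ.prod (stdGaussian (Param d))).map fun p => Φ (a' p.1 + s • p.2))
      ≤ ((α * δ ^ 2 / (2 * s ^ 2) : ℝ) : EReal) := by
  set G := stdGaussian (Param d)
  set v : Ω → Param d := fun ω => s⁻¹ • (a ω - a' ω) with hv
  have hvm : Measurable v := (ha.sub ha').const_smul s⁻¹
  set q : Ω × Param d → ℝ≥0∞ := fun p =>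
    ENNReal.ofReal (Real.exp (inner ℝ (v p.1) p.2 - ‖v p.1‖ ^ 2 / 2)) with hq
  have hqm : Measurable q := by
    have h1 : Measurable fun p : Ω × Param d => v p.1 := hvm.comp measurable_fst
    have h2 : Measurable fun p : Ω × Param d => inner ℝ (v p.1) p.2 := h1.inner measurable_snd
    exact (Real.measurable_exp.comp (h2.sub ((h1.norm.pow_const 2).div_const 2))).ennreal_ofReal
  have hΨ : ∀ {a : Ω → Param d}, Measurable a →
      Measurable fun p : Ω × Param d => Φ (a p.1 + s • p.2) := fun ha =>
    hΦ.comp ((ha.comp measurable_fst).add (measurable_snd.const_smul s))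
  -- Shifting the noise by `v ω` in each fibre turns `a'` into `a`. Both laws thus become images of
  -- one base measure under one map, the first with the extra density `q`, as data processing
  -- requires.
  have hmap : (γ.prod G).map (fun p => Φ (a p.1 + s • p.2))
      = ((γ.prod G).withDensity q).map (fun p => Φ (a' p.1 + s • p.2)) := by
    ext S hS
    rw [Measure.map_apply (hΨ ha) hS, Measure.map_apply (hΨ ha') hS,
      withDensity_apply _ (hΨ ha' hS), ← lintegral_indicator (hΨ ha' hS),
      lintegral_prod _ (hqm.indicator (hΨ ha' hS)).aemeasurable, Measure.prod_apply (hΨ ha hS)]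
    refine lintegral_congr fun ω => ?_
    have hS' : MeasurableSet {w : Param d | Φ (a' ω + s • w) ∈ S} :=
      measurable_prodMk_left (x := ω) (hΨ ha' hS)
    have e : Prod.mk ω ⁻¹' ((fun p : Ω × Param d => Φ (a p.1 + s • p.2)) ⁻¹' S)
        = (· + v ω) ⁻¹' {w : Param d | Φ (a' ω + s • w) ∈ S} := by
      ext w
      simp only [Set.mem_preimage, Set.mem_ofPred_eq, hv, smul_add, smul_smul,
        mul_inv_cancel₀ hs.ne', one_smul]
      rw [show a' ω + (s • w + (a ω - a' ω)) = a ω + s • w by abel]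
    rw [e, ← Measure.map_apply (by fun_prop) hS', ← stdGaussian_withDensity_exp,
      withDensity_apply _ hS', ← lintegral_indicator hS']
    rfl
  rw [hmap]
  refine renyiDiv_le_of_lintegral_le hα ((withDensity_absolutelyContinuous _ _).map (hΨ ha')) ?_
  refine (lintegral_rnDeriv_map_rpow_le _ hqm (hΨ ha') hα).trans ?_
  rw [lintegral_prod _ (hqm.pow_const _).aemeasurable]
  simp only [hq, G, lintegral_exp_rpow_stdGaussian]
  calc ∫⁻ ω, ENNReal.ofReal (Real.exp (α * (α - 1) * ‖v ω‖ ^ 2 / 2)) ∂γ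
      ≤ ∫⁻ _, ENNReal.ofReal (Real.exp ((α - 1) * (α * δ ^ 2 / (2 * s ^ 2)))) ∂γ := by
        refine lintegral_mono_ae (hδ.mono fun ω hω => ?_)
        refine ENNReal.ofReal_le_ofReal (Real.exp_le_exp.2 ?_)
        have h1 : ‖v ω‖ ^ 2 ≤ δ ^ 2 / s ^ 2 := by
          rw [hv, norm_smul, Real.norm_of_nonneg (inv_pos.2 hs).le, mul_pow, inv_pow,
            inv_mul_eq_div]
          gcongr
        have h2 : 0 ≤ α * (α - 1) / 2 := by
          have : 0 ≤ α - 1 := by linarith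
          positivity
        calc α * (α - 1) * ‖v ω‖ ^ 2 / 2 = α * (α - 1) / 2 * ‖v ω‖ ^ 2 := by ring
          _ ≤ α * (α - 1) / 2 * (δ ^ 2 / s ^ 2) := mul_le_mul_of_nonneg_left h1 h2
          _ = _ := by field_simp
    _ = _ := by simp

end SGLU

namespace SGLU

/-! ### Gradients of convex functions on a convex set -/

theorem smul_mem_ball_of_lt_one {E : Type*} [NormedAddCommGroup E] [NormedSpace ℝ E]
    {R t : ℝ} (hR : 0 < R) (ht0 : 0 ≤ t) (ht : t < 1) {x : E}
    (hx : x ∈ Metric.closedBall (0 : E) R) : t • x ∈ Metric.ball (0 : E) R := by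
  rw [mem_closedBall_zero_iff] at hx
  rw [mem_ball_zero_iff, norm_smul, Real.norm_of_nonneg ht0]
  nlinarith [norm_nonneg x]

theorem tendsto_comp_smul_of_lipschitz {E : Type*} [NormedAddCommGroup E] [NormedSpace ℝ E]
    {R K : ℝ} (hR : 0 < R) {g : E → E}
    (hlip : ∀ x ∈ Metric.closedBall (0 : E) R, ∀ y ∈ Metric.closedBall (0 : E) R,
      ‖g x - g y‖ ≤ K * ‖x - y‖) {x : E} (hx : x ∈ Metric.closedBall (0 : E) R) :
    Filter.Tendsto (fun t : ℝ => g (t • x)) (nhdsWithin 1 (Set.Ioo 0 1)) (nhds (g x)) := by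
  have hcont : Filter.Tendsto (fun t : ℝ => K * ‖t • x - x‖) (nhdsWithin 1 (Set.Ioo 0 1))
      (nhds 0) := by
    have : Continuous fun t : ℝ => K * ‖t • x - x‖ := by fun_prop
    simpa using (this.tendsto 1).mono_left nhdsWithin_le_nhds
  rw [tendsto_iff_norm_sub_tendsto_zero]
  refine squeeze_zero' (Filter.Eventually.of_forall fun _ => norm_nonneg _) ?_ hcont
  filter_upwards [self_mem_nhdsWithin] with t ht
  exact hlip _ (Metric.ball_subset_closedBall (smul_mem_ball_of_lt_one hR ht.1.le ht.2 hx)) _ hx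

section Gradient

variable {E : Type*} [NormedAddCommGroup E] [InnerProductSpace ℝ E] [CompleteSpace E]

/-- Along the segment from `x` to `y`, `h` minus its linearization at `x` has derivative `⟨g(x + t(y
- x)) - g x, y - x⟩`. Monotonicity of `g` controls `t` times this derivative, hence its sign for `t
> 0`. -/
theorem add_inner_le_of_monotone_gradient {s : Set E} (hs : Convex ℝ s) {h : E → ℝ} {g : E → E}
    (hg : ∀ x ∈ s, HasGradientAt h (g x) x)
    (hmono : ∀ x ∈ s, ∀ y ∈ s, 0 ≤ inner ℝ (x - y) (g x - g y)) {x y : E} (hx : x ∈ s)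
    (hy : y ∈ s) : h x + inner ℝ (g x) (y - x) ≤ h y := by
  have hmem : ∀ t ∈ Set.Icc (0 : ℝ) 1, x + t • (y - x) ∈ s := fun t ht =>
    hs.add_smul_sub_mem hx hy ht
  have hd : ∀ t ∈ Set.Icc (0 : ℝ) 1,
      HasDerivAt (fun t : ℝ => h (x + t • (y - x)) - t * inner ℝ (g x) (y - x))
        (inner ℝ (g (x + t • (y - x)) - g x) (y - x)) t := by
    intro t ht
    have h1 : HasDerivAt (fun t : ℝ => x + t • (y - x)) (y - x) t := by
      simpa using ((hasDerivAt_id t).smul_const (y - x)).const_add x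
    have h2 := (hg _ (hmem t ht)).hasFDerivAt.comp_hasDerivAt t h1
    have h3 := h2.sub ((hasDerivAt_id t).mul_const (inner ℝ (g x) (y - x)))
    exact h3.congr_deriv (by simp [inner_sub_left])
  have hm : MonotoneOn (fun t : ℝ => h (x + t • (y - x)) - t * inner ℝ (g x) (y - x))
      (Set.Icc 0 1) := by
    refine monotoneOn_of_deriv_nonneg (convex_Icc 0 1)
      (fun t ht => (hd t ht).continuousAt.continuousWithinAt)
      (fun t ht => (hd t (interior_subset ht)).differentiableAt.differentiableWithinAt) ?_
    intro t ht
    rw [(hd t (interior_subset ht)).deriv]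
    rw [interior_Icc] at ht
    have h1 := hmono _ (hmem t (Set.Ioo_subset_Icc_self ht)) x hx
    rw [add_sub_cancel_left, real_inner_smul_left, real_inner_comm] at h1
    exact nonneg_of_mul_nonneg_right h1 ht.1
  have := hm (Set.left_mem_Icc.2 zero_le_one) (Set.right_mem_Icc.2 zero_le_one) zero_le_one
  simp at this
  linarith

/-- The one-sided bound says that `c/2 ‖z‖² - h` has monotone gradient, so the previous inequality
applies to it. -/
theorem le_add_inner_add_sq_of_gradient {s : Set E} (hs : Convex ℝ s) {h : E → ℝ} {g : E → E}
    {c : ℝ} (hg : ∀ x ∈ s, HasGradientAt h (g x) x)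
    (hupper : ∀ x ∈ s, ∀ y ∈ s, inner ℝ (x - y) (g x - g y) ≤ c * ‖x - y‖ ^ 2) {x y : E}
    (hx : x ∈ s) (hy : y ∈ s) :
    h y ≤ h x + inner ℝ (g x) (y - x) + c / 2 * ‖y - x‖ ^ 2 := by
  have hg' : ∀ x ∈ s, HasGradientAt (fun z => c / 2 * ‖z‖ ^ 2 - h z) (c • x - g x) x := by
    intro x hx
    rw [hasGradientAt_iff_hasFDerivAt]
    have h1 := (((hasStrictFDerivAt_norm_sq x).hasFDerivAt).const_mul (c / 2)).sub
      (hg x hx).hasFDerivAt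
    refine h1.congr_fderiv ?_
    ext z
    simp
    ring
  have := add_inner_le_of_monotone_gradient hs hg' (fun x hx y hy => by
    have h1 := hupper x hx y hy
    rw [show c • x - g x - (c • y - g y) = c • (x - y) - (g x - g y) by
      rw [smul_sub]; abel, inner_sub_right, real_inner_smul_right, real_inner_self_eq_norm_sq]
    linarith) hx hy
  have h2 : ‖y - x‖ ^ 2 = ‖y‖ ^ 2 - 2 * inner ℝ x y + ‖x‖ ^ 2 := by
    rw [norm_sub_sq_real, real_inner_comm]
  rw [inner_sub_left, real_inner_smul_left, inner_sub_right x, real_inner_self_eq_norm_sq] at this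
  rw [h2]
  linarith

/-- Co-coercivity between two points whose gradient steps towards each other stay in the domain. -/
theorem norm_gradient_sub_le_of_step_mem {s : Set E} (hs : Convex ℝ s) {h : E → ℝ} {g : E → E}
    {c : ℝ} (hc : 0 < c) (hg : ∀ x ∈ s, HasGradientAt h (g x) x)
    (hmono : ∀ x ∈ s, ∀ y ∈ s, 0 ≤ inner ℝ (x - y) (g x - g y))
    (hupper : ∀ x ∈ s, ∀ y ∈ s, inner ℝ (x - y) (g x - g y) ≤ c * ‖x - y‖ ^ 2) {x y : E}
    (hx : x ∈ s) (hy : y ∈ s) (hxz : x - c⁻¹ • (g x - g y) ∈ s)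
    (hyz : y - c⁻¹ • (g y - g x) ∈ s) : ‖g x - g y‖ ≤ c * ‖x - y‖ := by
  -- Evaluate `h` at `y - c⁻¹(g y - g x)`: bound it below by the tangent at `x` and above by the
  -- quadratic at `y`. Adding this to its mirror image gives co-coercivity.
  have key : ∀ x ∈ s, ∀ y ∈ s, y - c⁻¹ • (g y - g x) ∈ s →
      c⁻¹ / 2 * ‖g y - g x‖ ^ 2 ≤ h y - h x - inner ℝ (g x) (y - x) := by
    intro x hx y hy hz
    have h1 := add_inner_le_of_monotone_gradient hs hg hmono hx hz
    have h2 := le_add_inner_add_sq_of_gradient hs hg hupper hy hz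
    rw [show y - c⁻¹ • (g y - g x) - x = (y - x) - c⁻¹ • (g y - g x) by abel, inner_sub_right,
      real_inner_smul_right] at h1
    rw [sub_sub_cancel_left, inner_neg_right, norm_neg, norm_smul, real_inner_smul_right,
      mul_pow, Real.norm_of_nonneg (inv_pos.2 hc).le] at h2
    have h3 : inner ℝ (g y) (g y - g x) - inner ℝ (g x) (g y - g x) = ‖g y - g x‖ ^ 2 := by
      rw [← inner_sub_left, real_inner_self_eq_norm_sq]
    have h4 : c / 2 * (c⁻¹ ^ 2 * ‖g y - g x‖ ^ 2) = c⁻¹ / 2 * ‖g y - g x‖ ^ 2 := by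
      field_simp
    have h5 : c⁻¹ * inner ℝ (g y) (g y - g x) - c⁻¹ * inner ℝ (g x) (g y - g x)
        = c⁻¹ * ‖g y - g x‖ ^ 2 := by rw [← mul_sub, h3]
    linarith
  have h1 := key x hx y hy hyz
  have h2 := key y hy x hx hxz
  have h3 : inner ℝ (g x) (y - x) + inner ℝ (g y) (x - y) = - inner ℝ (g x - g y) (x - y) := by
    rw [← neg_sub x y, inner_neg_right, inner_sub_left]; ring
  rw [norm_sub_rev (g y)] at h1
  have h4 : c⁻¹ * ‖g x - g y‖ ^ 2 ≤ ‖g x - g y‖ * ‖x - y‖ :=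
    le_trans (by linarith) (real_inner_le_norm (g x - g y) (x - y))
  rw [inv_mul_le_iff₀ hc] at h4
  rcases (norm_nonneg (g x - g y)).eq_or_lt with h0 | h0
  · rw [← h0]; positivity
  · nlinarith

/-- Co-coercivity needs auxiliary points that may leave the ball when `x` and `y` are far apart.
Cutting the segment into short pieces keeps them inside, and the Lipschitz bounds add up along a
segment without loss. -/
theorem norm_gradient_sub_le_of_mem_ball {R K c : ℝ} (hc : 0 < c) {h : E → ℝ} {g : E → E}
    (hg : ∀ x ∈ Metric.ball (0 : E) R, HasGradientAt h (g x) x)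
    (hlip : ∀ x ∈ Metric.ball (0 : E) R, ∀ y ∈ Metric.ball (0 : E) R,
      ‖g x - g y‖ ≤ K * ‖x - y‖)
    (hmono : ∀ x ∈ Metric.ball (0 : E) R, ∀ y ∈ Metric.ball (0 : E) R,
      0 ≤ inner ℝ (x - y) (g x - g y))
    (hupper : ∀ x ∈ Metric.ball (0 : E) R, ∀ y ∈ Metric.ball (0 : E) R,
      inner ℝ (x - y) (g x - g y) ≤ c * ‖x - y‖ ^ 2) {x y : E}
    (hx : x ∈ Metric.ball (0 : E) R) (hy : y ∈ Metric.ball (0 : E) R) :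
    ‖g x - g y‖ ≤ c * ‖x - y‖ := by
  set r := max ‖x‖ ‖y‖ with hr
  have hrR : r < R := by simpa [hr] using And.intro hx hy
  -- With `n + 1` pieces, the crude constant `K` bounds the auxiliary displacement by less than `R -
  -- r`, the room left between the segment and the sphere.
  obtain ⟨n, hn⟩ := exists_nat_gt (c⁻¹ * (K * ‖x - y‖) / (R - r))
  have hN : (0 : ℝ) < (n : ℝ) + 1 := by positivity
  set p : ℕ → E := fun i => x + ((i : ℝ) / (n + 1)) • (y - x) with hp
  have hpr : ∀ i ≤ n + 1, ‖p i‖ ≤ r := by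
    intro i hi
    have h1 : (i : ℝ) ≤ n + 1 := by exact_mod_cast hi
    have : p i ∈ Metric.closedBall (0 : E) r :=
      (convex_closedBall (0 : E) r).add_smul_sub_mem (by simp [hr]) (by simp [hr])
        ⟨by positivity, (div_le_one hN).2 h1⟩
    simpa using this
  have hstep : ∀ i, ‖p i - p (i + 1)‖ = ‖x - y‖ / (n + 1) := by
    intro i
    have : p i - p (i + 1) = (1 / ((n : ℝ) + 1)) • (x - y) := by
      simp only [hp, Nat.cast_add, Nat.cast_one]
      rw [add_sub_add_left_eq_sub, ← sub_smul, ← neg_sub y x, smul_neg, ← neg_smul]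
      congr 1
      ring
    rw [this, norm_smul, Real.norm_of_nonneg (by positivity), one_div_mul_eq_div]
  have hball : ∀ i ≤ n + 1, p i ∈ Metric.ball (0 : E) R := fun i hi => by
    simpa using (hpr i hi).trans_lt hrR
  have hsmall : c⁻¹ * (K * (‖x - y‖ / (n + 1))) < R - r := by
    rw [div_lt_iff₀ (by linarith)] at hn
    have : c⁻¹ * (K * (‖x - y‖ / (n + 1))) = c⁻¹ * (K * ‖x - y‖) / (n + 1) := by ring
    rw [this, div_lt_iff₀ hN]
    nlinarith
  have hz : ∀ i ≤ n + 1, ∀ j ≤ n + 1, ‖p i - p j‖ = ‖x - y‖ / (n + 1) →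
      p i - c⁻¹ • (g (p i) - g (p j)) ∈ Metric.ball (0 : E) R := by
    intro i hi j hj hij
    rw [mem_ball_zero_iff]
    have h1 : ‖c⁻¹ • (g (p i) - g (p j))‖ ≤ c⁻¹ * (K * (‖x - y‖ / (n + 1))) := by
      rw [norm_smul, Real.norm_of_nonneg (inv_pos.2 hc).le, ← hij]
      exact mul_le_mul_of_nonneg_left (hlip _ (hball i hi) _ (hball j hj)) (inv_pos.2 hc).le
    calc _ ≤ ‖p i‖ + ‖c⁻¹ • (g (p i) - g (p j))‖ := norm_sub_le _ _
      _ < R := by linarith [hpr i hi]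
  have hloc : ∀ i ∈ Finset.range (n + 1),
      dist (g (p i)) (g (p (i + 1))) ≤ c * (‖x - y‖ / (n + 1)) := by
    intro i hi
    have hi' : i + 1 ≤ n + 1 := Finset.mem_range.1 hi
    have hi0 : i ≤ n + 1 := (Nat.le_succ i).trans hi'
    rw [dist_eq_norm, ← hstep i]
    exact norm_gradient_sub_le_of_step_mem (convex_ball (0 : E) R) hc hg hmono hupper
      (hball i hi0) (hball _ hi') (hz _ hi0 _ hi' (hstep i))
      (hz _ hi' _ hi0 (by rw [norm_sub_rev, hstep i]))
  have h0 : p 0 = x := by simp [hp]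
  have h1 : p (n + 1) = y := by
    simp only [hp, Nat.cast_add, Nat.cast_one]
    rw [div_self hN.ne', one_smul, add_sub_cancel]
  calc ‖g x - g y‖ = dist (g (p 0)) (g (p (n + 1))) := by rw [h0, h1, dist_eq_norm]
    _ ≤ ∑ i ∈ Finset.range (n + 1), dist (g (p i)) (g (p (i + 1))) :=
        dist_le_range_sum_dist (fun i => g (p i)) _
    _ ≤ ∑ i ∈ Finset.range (n + 1), c * (‖x - y‖ / (n + 1)) := Finset.sum_le_sum hloc
    _ = c * ‖x - y‖ := by
        rw [Finset.sum_const, Finset.card_range, nsmul_eq_mul]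
        push_cast
        field_simp

/-- A Lipschitz gradient on a closed ball that is monotone and satisfies the one-sided bound
`⟨x - y, g x - g y⟩ ≤ c ‖x - y‖²` is `c`-Lipschitz. -/
theorem norm_gradient_sub_le_of_mem_closedBall {R K c : ℝ} (hR : 0 < R) (hc : 0 ≤ c) {h : E → ℝ}
    {g : E → E} (hg : ∀ x ∈ Metric.closedBall (0 : E) R, HasGradientAt h (g x) x)
    (hlip : ∀ x ∈ Metric.closedBall (0 : E) R, ∀ y ∈ Metric.closedBall (0 : E) R,
      ‖g x - g y‖ ≤ K * ‖x - y‖)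
    (hmono : ∀ x ∈ Metric.closedBall (0 : E) R, ∀ y ∈ Metric.closedBall (0 : E) R,
      0 ≤ inner ℝ (x - y) (g x - g y))
    (hupper : ∀ x ∈ Metric.closedBall (0 : E) R, ∀ y ∈ Metric.closedBall (0 : E) R,
      inner ℝ (x - y) (g x - g y) ≤ c * ‖x - y‖ ^ 2) {x y : E}
    (hx : x ∈ Metric.closedBall (0 : E) R) (hy : y ∈ Metric.closedBall (0 : E) R) :
    ‖g x - g y‖ ≤ c * ‖x - y‖ := by
  have hsub := Metric.ball_subset_closedBall (x := (0 : E)) (ε := R)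
  -- The constant `c` may be `0`, while co-coercivity divides by it; hence the passage through `c' >
  -- c`. Boundary points are reached radially from the open ball.
  have hclosed : ∀ c' > c, ‖g x - g y‖ ≤ c' * ‖x - y‖ := by
    intro c' hc'
    have hlhs : Filter.Tendsto (fun t : ℝ => ‖g (t • x) - g (t • y)‖)
        (nhdsWithin 1 (Set.Ioo 0 1)) (nhds ‖g x - g y‖) :=
      ((tendsto_comp_smul_of_lipschitz hR hlip hx).sub
        (tendsto_comp_smul_of_lipschitz hR hlip hy)).norm
    have hrhs : Filter.Tendsto (fun t : ℝ => c' * ‖t • x - t • y‖)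
        (nhdsWithin 1 (Set.Ioo 0 1)) (nhds (c' * ‖x - y‖)) := by
      have : Continuous fun t : ℝ => c' * ‖t • x - t • y‖ := by fun_prop
      simpa using (this.tendsto 1).mono_left nhdsWithin_le_nhds
    have : (nhdsWithin (1 : ℝ) (Set.Ioo 0 1)).NeBot := right_nhdsWithin_Ioo_neBot zero_lt_one
    refine le_of_tendsto_of_tendsto hlhs hrhs ?_
    filter_upwards [self_mem_nhdsWithin] with t ht
    exact norm_gradient_sub_le_of_mem_ball (hc.trans_lt hc') (fun x hx => hg x (hsub hx))
      (fun x hx y hy => hlip x (hsub hx) y (hsub hy))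
      (fun x hx y hy => hmono x (hsub hx) y (hsub hy))
      (fun x hx y hy => (hupper x (hsub hx) y (hsub hy)).trans
        (mul_le_mul_of_nonneg_right hc'.le (sq_nonneg _)))
      (smul_mem_ball_of_lt_one hR ht.1.le ht.2 hx) (smul_mem_ball_of_lt_one hR ht.1.le ht.2 hy)
  have : Filter.Tendsto (fun c' : ℝ => c' * ‖x - y‖) (nhdsWithin c (Set.Ioi c))
      (nhds (c * ‖x - y‖)) := by
    have : Continuous fun c' : ℝ => c' * ‖x - y‖ := by fun_prop
    exact (this.tendsto c).mono_left nhdsWithin_le_nhds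
  exact ge_of_tendsto this (by filter_upwards [self_mem_nhdsWithin] with c' hc' using hclosed c' hc')

end Gradient

/-! ### The gradient step on the ball -/

theorem norm_gradStep_sub_le {d : ℕ} {R L m η : ℝ} (hR : 0 < R) (hL : 0 < L) (hη : 0 < η)
    (hηL : η ≤ 1 / L) (hc : 0 ≤ 1 - η * m) {f : Param d → ℝ}
    (hsmooth : SmoothOn L (Metric.closedBall 0 R) f)
    (hconv : StronglyConvexOn m (Metric.closedBall 0 R) f) {x y : Param d}
    (hx : x ∈ Metric.closedBall 0 R) (hy : y ∈ Metric.closedBall 0 R) :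
    ‖(x - η • gradient f x) - (y - η • gradient f y)‖ ≤ (1 - η * m) * ‖x - y‖ := by
  have e : ∀ x y : Param d, (x - η • gradient f x) - (y - η • gradient f y)
      = (x - y) - η • (gradient f x - gradient f y) := fun x y => by rw [smul_sub]; abel
  have hηL' : η * L ≤ 1 := by rwa [le_div_iff₀ hL] at hηL
  -- The gradient step is itself the gradient of `‖z‖²/2 - η f z`. It is monotone because `ηL ≤ 1`,
  -- and strong convexity gives the upper constant `1 - ηm`. The constant `1 + ηL` only serves to
  -- control the subdivision.
  refine norm_gradient_sub_le_of_mem_closedBall (h := fun z => 1 / 2 * ‖z‖ ^ 2 - η * f z)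
    (g := fun x => x - η • gradient f x) (K := 1 + η * L) hR hc ?_ ?_ ?_ ?_ hx hy
  · intro x hx
    rw [hasGradientAt_iff_hasFDerivAt]
    have h1 := (((hasStrictFDerivAt_norm_sq x).hasFDerivAt).const_mul (1 / 2)).sub
      ((hsmooth.1 x hx).hasGradientAt.hasFDerivAt.const_mul η)
    refine h1.congr_fderiv ?_
    ext z
    simp
  · intro x hx y hy
    rw [e, add_mul, one_mul, mul_assoc]
    refine (norm_sub_le _ _).trans (add_le_add le_rfl ?_)
    rw [norm_smul, Real.norm_of_nonneg hη.le]
    exact mul_le_mul_of_nonneg_left (hsmooth.2 x hx y hy) hη.le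
  · intro x hx y hy
    rw [e, inner_sub_right, real_inner_smul_right, real_inner_self_eq_norm_sq]
    have h1 := real_inner_le_norm (x - y) (gradient f x - gradient f y)
    have h2 := mul_le_mul_of_nonneg_left (hsmooth.2 x hx y hy) (norm_nonneg (x - y))
    have h3 := mul_le_mul_of_nonneg_left (h1.trans h2) hη.le
    have h4 := mul_le_mul_of_nonneg_right hηL' (sq_nonneg ‖x - y‖)
    nlinarith
  · intro x hx y hy
    rw [e, inner_sub_right, real_inner_smul_right, real_inner_self_eq_norm_sq]
    have h1 := mul_le_mul_of_nonneg_left (hconv x hx y hy) hη.le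
    linarith

/-- On the sphere the Lipschitz bound sees only directions into the ball, so the gradient is bounded
in the interior and the bound extends by continuity of the gradient. -/
theorem norm_gradient_le_of_lipschitzOn {d : ℕ} {R L M : ℝ} (hR : 0 < R) (hM : 0 ≤ M)
    {f : Param d → ℝ} (hsmooth : SmoothOn L (Metric.closedBall 0 R) f)
    (hlip : LipschitzOn M (Metric.closedBall 0 R) f) {x : Param d}
    (hx : x ∈ Metric.closedBall 0 R) : ‖gradient f x‖ ≤ M := by
  have hball : ∀ z ∈ Metric.ball (0 : Param d) R, ‖gradient f z‖ ≤ M := by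
    intro z hz
    have hz' := Metric.ball_subset_closedBall hz
    have h1 := (hsmooth.1 z hz').hasGradientAt.hasFDerivAt.le_of_lip' hM (by
      filter_upwards [Metric.isOpen_ball.mem_nhds hz] with w hw
      exact hlip w (Metric.ball_subset_closedBall hw) z hz')
    rwa [LinearIsometryEquiv.norm_map] at h1
  have : (nhdsWithin (1 : ℝ) (Set.Ioo 0 1)).NeBot := right_nhdsWithin_Ioo_neBot zero_lt_one
  refine le_of_tendsto (tendsto_comp_smul_of_lipschitz hR hsmooth.2 hx).norm ?_
  filter_upwards [self_mem_nhdsWithin] with t ht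
  exact hball _ (smul_mem_ball_of_lt_one hR ht.1.le ht.2 hx)

/-! ### Constraints on the constants in positive dimension -/

theorem exists_ne_mem_closedBall {d : ℕ} [NeZero d] {R : ℝ} (hR : 0 < R) :
    ∃ x ∈ Metric.closedBall (0 : Param d) R, 0 < ‖x - 0‖ := by
  obtain ⟨x, hx⟩ := exists_norm_eq (Param d) hR.le
  exact ⟨x, by simp [hx], by simpa [hx] using hR⟩

theorem StronglyConvexOn.le_of_smoothOn {d : ℕ} [NeZero d] {R L m : ℝ} (hR : 0 < R)
    {f : Param d → ℝ} (hsmooth : SmoothOn L (Metric.closedBall 0 R) f)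
    (hconv : StronglyConvexOn m (Metric.closedBall 0 R) f) : m ≤ L := by
  obtain ⟨x, hx, hpos⟩ := exists_ne_mem_closedBall (d := d) hR
  have h0 : (0 : Param d) ∈ Metric.closedBall 0 R := by simp [hR.le]
  have h1 := (hconv x hx 0 h0).trans (real_inner_le_norm _ _)
  have h2 := h1.trans (mul_le_mul_of_nonneg_left (hsmooth.2 x hx 0 h0) (norm_nonneg _))
  have h3 : m * ‖x - 0‖ ^ 2 ≤ L * ‖x - 0‖ ^ 2 := by linarith
  exact le_of_mul_le_mul_right h3 (by positivity)

theorem LipschitzOn.nonneg {d : ℕ} [NeZero d] {R M : ℝ} (hR : 0 < R) {f : Param d → ℝ}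
    (hlip : LipschitzOn M (Metric.closedBall 0 R) f) : 0 ≤ M := by
  obtain ⟨x, hx, hpos⟩ := exists_ne_mem_closedBall (d := d) hR
  have h0 : (0 : Param d) ∈ Metric.closedBall 0 R := by simp [hR.le]
  exact nonneg_of_mul_nonneg_left ((abs_nonneg _).trans (hlip x hx 0 h0)) hpos

/-! ### The projection onto the ball -/

theorem inner_sub_projBall_nonpos {d : ℕ} {R : ℝ} (hR : 0 ≤ R) (x : Param d) {z : Param d}
    (hz : z ∈ Metric.closedBall (0 : Param d) R) :
    inner ℝ (x - projBall R x) (z - projBall R x) ≤ 0 := by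
  rw [mem_closedBall_zero_iff] at hz
  unfold projBall
  split_ifs with h
  · simp
  · have h' := not_le.mp h
    have hx : 0 < ‖x‖ := hR.trans_lt h'
    have e : x - (R / ‖x‖) • x = (1 - R / ‖x‖) • x := by rw [sub_smul, one_smul]
    have h1 : 0 ≤ 1 - R / ‖x‖ := by
      rw [sub_nonneg, div_le_one hx]; exact h'.le
    rw [e, real_inner_smul_left, inner_sub_right, real_inner_smul_right,
      real_inner_self_eq_norm_sq]
    refine mul_nonpos_of_nonneg_of_nonpos h1 ?_
    have h2 := real_inner_le_norm x z
    have h3 : R / ‖x‖ * ‖x‖ ^ 2 = ‖x‖ * R := by field_simp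
    have h4 := mul_le_mul_of_nonneg_left hz hx.le
    linarith

theorem norm_projBall_sub_le {d : ℕ} {R : ℝ} (hR : 0 ≤ R) (x y : Param d) :
    ‖projBall R x - projBall R y‖ ≤ ‖x - y‖ := by
  set p := projBall R x
  set q := projBall R y
  have h1 : inner ℝ (x - p) (q - p) ≤ 0 := inner_sub_projBall_nonpos hR x (projBall_mem hR y)
  have h2 : inner ℝ (y - q) (p - q) ≤ 0 := inner_sub_projBall_nonpos hR y (projBall_mem hR x)
  have h3 : ‖p - q‖ ^ 2 ≤ inner ℝ (x - y) (p - q) := by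
    rw [← neg_sub p q, inner_neg_right] at h1
    have : inner ℝ (x - y) (p - q)
        = inner ℝ (x - p) (p - q) - inner ℝ (y - q) (p - q) + inner ℝ (p - q) (p - q) := by
      rw [← inner_sub_left, ← inner_add_left]
      congr 1
      abel
    rw [this, real_inner_self_eq_norm_sq]
    linarith
  have h4 := h3.trans (real_inner_le_norm _ _)
  rcases (norm_nonneg (p - q)).eq_or_lt with h0 | h0
  · rw [← h0]; exact norm_nonneg _
  · nlinarith

end SGLU

namespace SGLU

/-! ### The mini-batch drift -/

section Drift

variable {𝒳 : Type*} {d n b : ℕ} {f : Param d → 𝒳 → ℝ} {R L M m η σ : ℝ}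

theorem norm_batchStep_sub_le (hb : 0 < b) (hR : 0 < R) (hL : 0 < L) (hη : 0 < η)
    (hηL : η ≤ 1 / L) (hc : 0 ≤ 1 - η * m)
    (hsmooth : ∀ z : 𝒳, SmoothOn L (Metric.closedBall 0 R) (fun x => f x z))
    (hconv : ∀ z : 𝒳, StronglyConvexOn m (Metric.closedBall 0 R) (fun x => f x z))
    (D : Fin n → 𝒳) {β : Finset (Fin n)} (hβ : β.card = b) {x y : Param d}
    (hx : x ∈ Metric.closedBall 0 R) (hy : y ∈ Metric.closedBall 0 R) :
    ‖(x - η • batchGrad f b D β x) - (y - η • batchGrad f b D β y)‖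
      ≤ (1 - η * m) * ‖x - y‖ := by
  have hb' : (0 : ℝ) < b := by exact_mod_cast hb
  have e : ∀ x : Param d, x - η • batchGrad f b D β x
      = (1 / (b : ℝ)) • ∑ i ∈ β, (x - η • gradient (fun z => f z (D i)) x) := by
    intro x
    rw [Finset.sum_sub_distrib, Finset.sum_const, hβ, smul_sub, ← Nat.cast_smul_eq_nsmul ℝ,
      smul_smul, one_div_mul_cancel hb'.ne', one_smul, ← Finset.smul_sum, batchGrad,
      smul_comm η]
  rw [e, e, ← smul_sub, ← Finset.sum_sub_distrib, norm_smul, Real.norm_of_nonneg (by positivity)]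
  calc 1 / (b : ℝ) * ‖∑ i ∈ β, ((x - η • gradient (fun z => f z (D i)) x)
        - (y - η • gradient (fun z => f z (D i)) y))‖
      ≤ 1 / (b : ℝ) * ∑ _i ∈ β, (1 - η * m) * ‖x - y‖ := by
        refine mul_le_mul_of_nonneg_left (norm_sum_le_of_le _ fun i _ => ?_) (by positivity)
        exact norm_gradStep_sub_le hR hL hη hηL hc (hsmooth (D i)) (hconv (D i)) hx hy
    _ = _ := by
        rw [Finset.sum_const, hβ, nsmul_eq_mul, ← mul_assoc, one_div_mul_cancel hb'.ne', one_mul]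

theorem norm_batchStep_sub_batchStep_le (hR : 0 < R) (hM : 0 ≤ M) (hη : 0 < η)
    (hsmooth : ∀ z : 𝒳, SmoothOn L (Metric.closedBall 0 R) (fun x => f x z))
    (hlip : ∀ z : 𝒳, LipschitzOn M (Metric.closedBall 0 R) (fun x => f x z))
    {D D' : Fin n → 𝒳} {i : Fin n} (hD : ∀ j, j ≠ i → D j = D' j) (β : Finset (Fin n))
    {x : Param d} (hx : x ∈ Metric.closedBall 0 R) :
    ‖(x - η • batchGrad f b D β x) - (x - η • batchGrad f b D' β x)‖
      ≤ if i ∈ β then 2 * η * M / b else 0 := by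
  have hle : ‖∑ j ∈ β, (gradient (fun z => f z (D' j)) x - gradient (fun z => f z (D j)) x)‖
      ≤ if i ∈ β then 2 * M else 0 := by
    rw [← Finset.sum_ite_eq' β i (fun _ => 2 * M)]
    refine norm_sum_le_of_le _ fun j _ => ?_
    split_ifs with hj
    · have h1 := norm_gradient_le_of_lipschitzOn hR hM (hsmooth (D j)) (hlip (D j)) hx
      have h2 := norm_gradient_le_of_lipschitzOn hR hM (hsmooth (D' j)) (hlip (D' j)) hx
      exact (norm_sub_le _ _).trans (by linarith)
    · rw [hD j hj, sub_self, norm_zero]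
  rw [sub_sub_sub_cancel_left, ← smul_sub, batchGrad, batchGrad, ← smul_sub,
    ← Finset.sum_sub_distrib, smul_smul, norm_smul, Real.norm_of_nonneg (by positivity)]
  refine (mul_le_mul_of_nonneg_left hle (by positivity)).trans_eq ?_
  split_ifs <;> ring

end Drift

/-! ### Couplings inside the ball -/

/-- `μ` and `ν` admit a coupling supported on pairs of points of the ball of radius `R` that are at
distance at most `δ`. -/
def IsCoupled {d : ℕ} (R δ : ℝ) (μ ν : Measure (Param d)) : Prop :=
  ∃ γ : Measure (Param d × Param d), IsProbabilityMeasure γ ∧ γ.map Prod.fst = μ ∧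
    γ.map Prod.snd = ν ∧ ∀ᵐ p ∂γ, p.1 ∈ Metric.closedBall (0 : Param d) R ∧
      p.2 ∈ Metric.closedBall (0 : Param d) R ∧ ‖p.1 - p.2‖ ≤ δ

/-- The law `μ` is a probability measure supported on the ball of radius `R`. -/
def InBall {d : ℕ} (R : ℝ) (μ : Measure (Param d)) : Prop :=
  IsProbabilityMeasure μ ∧ ∀ᵐ x ∂μ, x ∈ Metric.closedBall (0 : Param d) R

section Coupling

variable {d : ℕ} {R δ : ℝ} {μ ν : Measure (Param d)}

theorem norm_sub_le_of_mem_closedBall {x y : Param d} (hx : x ∈ Metric.closedBall 0 R)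
    (hy : y ∈ Metric.closedBall 0 R) : ‖x - y‖ ≤ 2 * R := by
  rw [mem_closedBall_zero_iff] at hx hy
  exact (norm_sub_le _ _).trans (by linarith)

theorem isCoupled_map {Ω : Type*} [MeasurableSpace Ω] (P : Measure Ω) [IsProbabilityMeasure P]
    {u v : Ω → Param d} (hu : Measurable u) (hv : Measurable v)
    (h : ∀ᵐ ω ∂P, u ω ∈ Metric.closedBall (0 : Param d) R ∧
      v ω ∈ Metric.closedBall (0 : Param d) R ∧ ‖u ω - v ω‖ ≤ δ) :
    IsCoupled R δ (P.map u) (P.map v) := by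
  have huv := hu.prodMk hv
  refine ⟨P.map fun ω => (u ω, v ω), Measure.isProbabilityMeasure_map huv.aemeasurable, ?_, ?_, ?_⟩
  · rw [Measure.map_map measurable_fst huv]
    rfl
  · rw [Measure.map_map measurable_snd huv]
    rfl
  · have hm : MeasurableSet {p : Param d × Param d | p.1 ∈ Metric.closedBall (0 : Param d) R ∧
        p.2 ∈ Metric.closedBall (0 : Param d) R ∧ ‖p.1 - p.2‖ ≤ δ} :=
      (measurable_fst Metric.isClosed_closedBall.measurableSet).inter
        ((measurable_snd Metric.isClosed_closedBall.measurableSet).inter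
          (measurableSet_le (measurable_fst.sub measurable_snd).norm measurable_const))
    exact (ae_map_iff huv.aemeasurable hm).2 h

theorem IsCoupled.symm (h : IsCoupled R δ μ ν) : IsCoupled R δ ν μ := by
  obtain ⟨γ, hγ, h1, h2, h3⟩ := h
  rw [← h1, ← h2]
  exact isCoupled_map γ measurable_snd measurable_fst
    (h3.mono fun p hp => ⟨hp.2.1, hp.1, by rw [norm_sub_rev]; exact hp.2.2⟩)

theorem IsCoupled.min_two_mul (h : IsCoupled R δ μ ν) : IsCoupled R (min δ (2 * R)) μ ν := by
  obtain ⟨γ, hγ, h1, h2, h3⟩ := h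
  exact ⟨γ, hγ, h1, h2, h3.mono fun p hp =>
    ⟨hp.1, hp.2.1, le_min hp.2.2 (norm_sub_le_of_mem_closedBall hp.1 hp.2.1)⟩⟩

theorem InBall.isCoupled (hμ : InBall R μ) (hν : InBall R ν) : IsCoupled R (2 * R) μ ν := by
  have := hμ.1
  have := hν.1
  have h1 : (μ.prod ν).map Prod.fst = μ := by simp
  have h2 : (μ.prod ν).map Prod.snd = ν := by simp
  refine ⟨μ.prod ν, inferInstance, h1, h2, ?_⟩
  have h1' := hμ.2
  have h2' := hν.2
  rw [← h1] at h1'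
  rw [← h2] at h2'
  filter_upwards [ae_of_ae_map measurable_fst.aemeasurable h1',
    ae_of_ae_map measurable_snd.aemeasurable h2'] with p hp1 hp2
  exact ⟨hp1, hp2, norm_sub_le_of_mem_closedBall hp1 hp2⟩

end Coupling

/-! ### One iteration -/

section Step

variable {𝒳 : Type*} {d n b : ℕ} {f : Param d → 𝒳 → ℝ} {R η σ δ δ' : ℝ}
  {D D' : Fin n → 𝒳} {β : Finset (Fin n)} {μ ν : Measure (Param d)}

theorem measurable_batchStep (f : Param d → 𝒳 → ℝ) (η : ℝ) (b : ℕ) (D : Fin n → 𝒳)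
    (β : Finset (Fin n)) : Measurable fun x : Param d => x - η • batchGrad f b D β x := by
  have hg : ∀ h : Param d → ℝ, Measurable (gradient h) := fun h =>
    (InnerProductSpace.toDual ℝ (Param d)).symm.continuous.measurable.comp (measurable_fderiv ℝ h)
  have hb : Measurable (batchGrad f b D β) :=
    (Finset.measurable_sum β fun i _ => hg fun z => f z (D i)).const_smul (1 / (b : ℝ))
  exact measurable_id.sub (hb.const_smul η)

theorem measurable_pnsgdUpdate_comp {Ω : Type*} [MeasurableSpace Ω] (f : Param d → 𝒳 → ℝ)
    (R η σ : ℝ) (b : ℕ) (D : Fin n → 𝒳) (β : Finset (Fin n)) {φ ψ : Ω → Param d}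
    (hφ : Measurable φ) (hψ : Measurable ψ) :
    Measurable fun ω => pnsgdUpdate f R η σ b D β (φ ω) (ψ ω) := by
  have h := (measurable_pnsgdUpdate f R η σ b D β).comp (hφ.prodMk hψ)
  simpa only [Function.comp_def] using h

theorem stepKernel_apply (f : Param d → 𝒳 → ℝ) (R η σ : ℝ) (b : ℕ) (D : Fin n → 𝒳)
    (β : Finset (Fin n)) (x : Param d) :
    stepKernel f R η σ b D β x = (stdGaussian (Param d)).map (pnsgdUpdate f R η σ b D β x) := rfl

/-- Realizes an iteration on `γ` times the noise space, so that two chains can share one noise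
variable. -/
theorem map_bind_stepKernel {Ω : Type*} [MeasurableSpace Ω] (γ : Measure Ω) [SFinite γ]
    {φ : Ω → Param d} (hφ : Measurable φ) :
    (γ.map φ).bind (stepKernel f R η σ b D β)
      = (γ.prod (stdGaussian (Param d))).map fun p => pnsgdUpdate f R η σ b D β (φ p.1) p.2 := by
  have hm := measurable_pnsgdUpdate_comp f R η σ b D β (hφ.comp measurable_fst)
    (measurable_snd (α := Ω) (β := Param d))
  simp only [Function.comp_apply] at hm
  ext S hS
  rw [Measure.bind_apply hS (Kernel.aemeasurable _), lintegral_map (Kernel.measurable_coe _ hS) hφ,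
    Measure.map_apply hm hS, Measure.prod_apply (hm hS)]
  refine lintegral_congr fun ω => ?_
  have hx : Measurable (pnsgdUpdate f R η σ b D β (φ ω)) :=
    measurable_pnsgdUpdate_comp f R η σ b D β measurable_const measurable_id
  rw [stepKernel_apply, Measure.map_apply hx hS, Set.preimage_preimage]

theorem pnsgdUpdate_mem (hR : 0 < R) (x w : Param d) :
    pnsgdUpdate f R η σ b D β x w ∈ Metric.closedBall (0 : Param d) R :=
  projBall_mem hR.le _

theorem norm_pnsgdUpdate_sub_le (hR : 0 < R) (x y w : Param d) :
    ‖pnsgdUpdate f R η σ b D β x w - pnsgdUpdate f R η σ b D' β y w‖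
      ≤ ‖(x - η • batchGrad f b D β x) - (y - η • batchGrad f b D' β y)‖ := by
  unfold pnsgdUpdate
  refine (norm_projBall_sub_le hR.le _ _).trans ?_
  rw [add_sub_add_right_eq_sub]

theorem InBall.step (hR : 0 < R) (hμ : InBall R μ) :
    InBall R (μ.bind (stepKernel f R η σ b D β)) := by
  have := hμ.1
  have hm := measurable_pnsgdUpdate f R η σ b D β
  have e := map_bind_stepKernel (f := f) (R := R) (η := η) (σ := σ) (b := b) (D := D) (β := β) μ
    measurable_id
  rw [Measure.map_id] at e
  rw [e]
  refine ⟨Measure.isProbabilityMeasure_map hm.aemeasurable, ?_⟩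
  refine (ae_map_iff (p := fun x => x ∈ Metric.closedBall (0 : Param d) R) hm.aemeasurable
    Metric.isClosed_closedBall.measurableSet).2 ?_
  exact Filter.Eventually.of_forall fun p => pnsgdUpdate_mem hR _ _

/-- Running one iteration with the same noise from coupled starting points. -/
theorem IsCoupled.step (hR : 0 < R)
    (hdrift : ∀ x ∈ Metric.closedBall (0 : Param d) R, ∀ y ∈ Metric.closedBall (0 : Param d) R,
      ‖x - y‖ ≤ δ → ‖(x - η • batchGrad f b D β x) - (y - η • batchGrad f b D' β y)‖ ≤ δ')
    (h : IsCoupled R δ μ ν) :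
    IsCoupled R δ' (μ.bind (stepKernel f R η σ b D β)) (ν.bind (stepKernel f R η σ b D' β)) := by
  obtain ⟨γ, hγ, h1, h2, h3⟩ := h
  set G := stdGaussian (Param d)
  have hm : ∀ (D : Fin n → 𝒳) {φ : Param d × Param d → Param d}, Measurable φ →
      Measurable fun q : (Param d × Param d) × Param d => pnsgdUpdate f R η σ b D β (φ q.1) q.2 :=
    fun D φ hφ => by
      have := measurable_pnsgdUpdate_comp f R η σ b D β
        (hφ.comp (measurable_fst (α := Param d × Param d) (β := Param d))) measurable_snd
      simpa only [Function.comp_apply] using this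
  have hm1 := hm D measurable_fst
  have hm2 := hm D' measurable_snd
  rw [← h1, ← h2, map_bind_stepKernel γ measurable_fst, map_bind_stepKernel γ measurable_snd]
  refine isCoupled_map (γ.prod G) hm1 hm2 ?_
  have hfst : (γ.prod G).map Prod.fst = γ := by simp
  rw [← hfst] at h3
  filter_upwards [ae_of_ae_map measurable_fst.aemeasurable h3] with q hq
  exact ⟨pnsgdUpdate_mem hR _ _, pnsgdUpdate_mem hR _ _,
    (norm_pnsgdUpdate_sub_le hR _ _ _).trans (hdrift _ hq.1 _ hq.2.1 hq.2.2)⟩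

theorem IsCoupled.renyiDiv_step_le {α : ℝ} (hα : 1 < α) (hη : 0 < η) (hσ : 0 < σ)
    (hdrift : ∀ x ∈ Metric.closedBall (0 : Param d) R, ∀ y ∈ Metric.closedBall (0 : Param d) R,
      ‖x - y‖ ≤ δ → ‖(x - η • batchGrad f b D β x) - (y - η • batchGrad f b D β y)‖ ≤ δ')
    (h : IsCoupled R δ μ ν) :
    renyiDiv α (μ.bind (stepKernel f R η σ b D β)) (ν.bind (stepKernel f R η σ b D β))
      ≤ ((α * δ' ^ 2 / (2 * (2 * η * σ ^ 2)) : ℝ) : EReal) := by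
  obtain ⟨γ, hγ, h1, h2, h3⟩ := h
  have hs : 0 < √(2 * η * σ ^ 2) := Real.sqrt_pos.2 (by positivity)
  have hsq : √(2 * η * σ ^ 2) ^ 2 = 2 * η * σ ^ 2 := Real.sq_sqrt (by positivity)
  have hd := measurable_batchStep f η b D β
  rw [← h1, ← h2, map_bind_stepKernel γ measurable_fst, map_bind_stepKernel γ measurable_snd, ← hsq]
  exact renyiDiv_map_gaussian_le γ (hd.comp measurable_fst) (hd.comp measurable_snd) hs hα
    (h3.mono fun p hp => hdrift _ hp.1 _ hp.2.1 hp.2.2) (measurable_projBall R)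

end Step

/-! ### Sequences of iterations -/

/-- The law after the iterations with the mini-batches in `l`, from a starting point of law `μ`. -/
noncomputable def runBatches {𝒳 : Type*} {d n : ℕ} (f : Param d → 𝒳 → ℝ) (R η σ : ℝ) (b : ℕ)
    (D : Fin n → 𝒳) (l : List (Finset (Fin n))) (μ : Measure (Param d)) : Measure (Param d) :=
  l.foldl (fun μ β => μ.bind (stepKernel f R η σ b D β)) μ

/-- The mini-batches of `t` epochs. -/
def MiniBatches.epochs {n b : ℕ} (B : MiniBatches n b) (t : ℕ) : List (Finset (Fin n)) :=
  (List.replicate t (List.ofFn B.batch)).flatten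

section Batches

variable {n b : ℕ} (B : MiniBatches n b)

theorem MiniBatches.epochs_add (s t : ℕ) : B.epochs (s + t) = B.epochs s ++ B.epochs t := by
  rw [epochs, List.replicate_add, List.flatten_append]
  rfl

theorem MiniBatches.epochs_one : B.epochs 1 = List.ofFn B.batch := by simp [epochs]

theorem MiniBatches.length_epochs (t : ℕ) : (B.epochs t).length = t * (n / b) := by
  simp [epochs]

theorem MiniBatches.card_of_mem_epochs {t : ℕ} {β : Finset (Fin n)} (hβ : β ∈ B.epochs t) :
    β.card = b := by
  obtain ⟨l, hl, hβ⟩ := List.mem_flatten.1 hβ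
  rw [(List.mem_replicate.1 hl).2] at hβ
  obtain ⟨j, rfl⟩ := List.mem_ofFn.1 hβ
  exact B.card_batch j

theorem MiniBatches.countP_epochs_one_le (i : Fin n) :
    (B.epochs 1).countP (fun β => decide (i ∈ β)) ≤ 1 := by
  obtain ⟨j, -, hj⟩ := B.existsUnique_mem i
  rw [B.epochs_one, List.ofFn_eq_map, List.countP_map]
  -- Only the position `j` of the batch containing `i` can count, and `j` occurs once in the list of
  -- positions.
  refine le_trans (List.countP_mono_left (q := fun k => k == j) ?_)
    (List.nodup_iff_count_le_one.1 (List.nodup_finRange _) j)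
  intro k _ hk
  have := hj k (by simpa using hk)
  simp [this]

end Batches

section Run

variable {𝒳 : Type*} {d n b : ℕ} {f : Param d → 𝒳 → ℝ} {R L M m η σ : ℝ}

theorem runBatches_append (D : Fin n → 𝒳) (l l' : List (Finset (Fin n)))
    (μ : Measure (Param d)) :
    runBatches f R η σ b D (l ++ l') μ
      = runBatches f R η σ b D l' (runBatches f R η σ b D l μ) :=
  List.foldl_append

theorem bind_foldl_stepKernel (D : Fin n → 𝒳) (l : List (Finset (Fin n)))
    (κ : Kernel (Param d) (Param d)) (μ : Measure (Param d)) :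
    μ.bind (l.foldl (fun (κ : Kernel (Param d) (Param d)) β =>
         (stepKernel f R η σ b D β).comp κ) κ : Kernel (Param d) (Param d))
      = runBatches f R η σ b D l (μ.bind κ) := by
  induction l generalizing κ with
  | nil => rfl
  | cons β l ih =>
    rw [List.foldl_cons, ih, runBatches, runBatches, List.foldl_cons, Measure.comp_assoc]

theorem bind_pnsgdKernel (B : MiniBatches n b) (D : Fin n → 𝒳) (t : ℕ) (μ : Measure (Param d)) :
    μ.bind (pnsgdKernel f R η σ B D t) = runBatches f R η σ b D (B.epochs t) μ := by
  induction t with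
  | zero => exact Measure.id_comp
  | succ t ih =>
    rw [pnsgdKernel, ← Measure.comp_assoc, ih, epochKernel, bind_foldl_stepKernel,
      B.epochs_add, runBatches_append, B.epochs_one]
    congr 1
    exact Measure.id_comp

theorem InBall.run (hR : 0 < R) (D : Fin n → 𝒳) (l : List (Finset (Fin n)))
    {μ : Measure (Param d)} (hμ : InBall R μ) : InBall R (runBatches f R η σ b D l μ) := by
  induction l generalizing μ with
  | nil => exact hμ
  | cons β l ih => exact ih (hμ.step hR)

theorem IsCoupled.run_of_eq {c δ : ℝ} (hc : 0 ≤ c) (hR : 0 < R) {D : Fin n → 𝒳}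
    {l : List (Finset (Fin n))}
    (hdrift : ∀ β ∈ l, ∀ x ∈ Metric.closedBall (0 : Param d) R,
      ∀ y ∈ Metric.closedBall (0 : Param d) R,
      ‖(x - η • batchGrad f b D β x) - (y - η • batchGrad f b D β y)‖ ≤ c * ‖x - y‖)
    {μ ν : Measure (Param d)} (h : IsCoupled R δ μ ν) :
    IsCoupled R (c ^ l.length * δ) (runBatches f R η σ b D l μ) (runBatches f R η σ b D l ν) := by
  induction l generalizing μ ν δ with
  | nil => simpa [runBatches] using h
  | cons β l ih =>
    have := ih (fun β' hβ' => hdrift β' (List.mem_cons_of_mem _ hβ')) (h.step (σ := σ) hR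
      (δ' := c * δ) fun x hx y hy hxy => (hdrift β List.mem_cons_self x hx y hy).trans
        (mul_le_mul_of_nonneg_left hxy hc))
    rwa [List.length_cons, pow_succ, mul_assoc]

/-- The position of the batches containing `i` is not known, so contraction of the errors already
made is discarded; only the initial distance keeps its factor. -/
theorem IsCoupled.run {c δ e : ℝ} (hc : 0 ≤ c) (hc1 : c ≤ 1) (he : 0 ≤ e) (hR : 0 < R)
    {D D' : Fin n → 𝒳} {i : Fin n} {l : List (Finset (Fin n))}
    (hdrift : ∀ β ∈ l, ∀ x ∈ Metric.closedBall (0 : Param d) R,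
      ∀ y ∈ Metric.closedBall (0 : Param d) R,
      ‖(x - η • batchGrad f b D β x) - (y - η • batchGrad f b D' β y)‖
        ≤ c * ‖x - y‖ + if i ∈ β then e else 0)
    {μ ν : Measure (Param d)} (h : IsCoupled R δ μ ν) :
    IsCoupled R (c ^ l.length * δ + l.countP (fun β => decide (i ∈ β)) * e)
      (runBatches f R η σ b D l μ) (runBatches f R η σ b D' l ν) := by
  induction l using List.reverseRecOn with
  | nil => simpa [runBatches] using h
  | append_singleton l β ih =>
    rw [runBatches_append, runBatches_append]
    refine (ih fun β' hβ' => hdrift β' (List.mem_append_left _ hβ')).step hR ?_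
    intro x hx y hy hxy
    refine (hdrift β (by simp) x hx y hy).trans ?_
    have h1 := mul_le_mul_of_nonneg_left hxy hc
    have h2 : c * ((l.countP fun β => decide (i ∈ β)) * e)
        ≤ (l.countP fun β => decide (i ∈ β)) * e :=
      mul_le_of_le_one_left (by positivity) hc1
    rw [List.length_append, List.length_singleton, pow_succ, List.countP_append,
      List.countP_singleton]
    push_cast
    by_cases hi : i ∈ β
    · simp only [hi, if_true, decide_true]
      linarith
    · simp only [hi, if_false, decide_false, Bool.false_eq_true]
      linarith

/-- An epoch maps a distance `δ` to at most `c^(n/b) δ + e`, since exactly one batch contains `i`;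
the closed form solves this recursion. -/
theorem IsCoupled.run_epochs {c δ e : ℝ} (hc : 0 ≤ c) (hc1 : c < 1) (he : 0 ≤ e) (hR : 0 < R)
    (hnb : n / b ≠ 0) (B : MiniBatches n b) {D D' : Fin n → 𝒳} {i : Fin n}
    (hdrift : ∀ β : Finset (Fin n), β.card = b → ∀ x ∈ Metric.closedBall (0 : Param d) R,
      ∀ y ∈ Metric.closedBall (0 : Param d) R,
      ‖(x - η • batchGrad f b D β x) - (y - η • batchGrad f b D' β y)‖
        ≤ c * ‖x - y‖ + if i ∈ β then e else 0)
    {μ ν : Measure (Param d)} (h : IsCoupled R δ μ ν) (t : ℕ) :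
    IsCoupled R (c ^ (t * (n / b)) * δ + (1 - c ^ (t * (n / b))) / (1 - c ^ (n / b)) * e)
      (runBatches f R η σ b D (B.epochs t) μ) (runBatches f R η σ b D' (B.epochs t) ν) := by
  have hq : c ^ (n / b) < 1 := pow_lt_one₀ hc hc1 hnb
  have hq' : 1 - c ^ (n / b) ≠ 0 := by linarith
  have mono : ∀ {δ₁ δ₂ : ℝ} {μ ν : Measure (Param d)}, δ₁ ≤ δ₂ → IsCoupled R δ₁ μ ν →
      IsCoupled R δ₂ μ ν := by
    rintro δ₁ δ₂ μ ν hle ⟨γ, hγ, h1, h2, h3⟩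
    exact ⟨γ, hγ, h1, h2, h3.mono fun p hp => ⟨hp.1, hp.2.1, hp.2.2.trans hle⟩⟩
  induction t with
  | zero => simpa [runBatches, MiniBatches.epochs] using h
  | succ t ih =>
    rw [B.epochs_add, runBatches_append, runBatches_append]
    refine mono ?_ (ih.run hc hc1.le he hR (i := i) fun β hβ =>
      hdrift β (B.card_of_mem_epochs hβ))
    have h1 : ((B.epochs 1).countP (fun β => decide (i ∈ β)) : ℝ) ≤ 1 := by
      exact_mod_cast B.countP_epochs_one_le i
    have h2 := mul_le_mul_of_nonneg_right h1 he
    rw [B.length_epochs, one_mul, add_mul, one_mul, pow_add]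
    have h3 : (1 - c ^ (t * (n / b)) * c ^ (n / b)) / (1 - c ^ (n / b)) * e
        = c ^ (n / b) * ((1 - c ^ (t * (n / b))) / (1 - c ^ (n / b)) * e) + e := by
      field_simp
      ring
    rw [h3]
    linarith

/-- Privacy amplification: the Rényi divergence after the iterations in `l` is governed by the
distance of the coupled trajectories before the noise of the last iteration. -/
theorem IsCoupled.renyiDiff_run_le {α c δ : ℝ} (hα : 1 < α) (hη : 0 < η) (hσ : 0 < σ)
    (hc : 0 ≤ c) (hR : 0 < R) {D : Fin n → 𝒳} {l : List (Finset (Fin n))} (hl : l ≠ [])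
    (hdrift : ∀ β ∈ l, ∀ x ∈ Metric.closedBall (0 : Param d) R,
      ∀ y ∈ Metric.closedBall (0 : Param d) R,
      ‖(x - η • batchGrad f b D β x) - (y - η • batchGrad f b D β y)‖ ≤ c * ‖x - y‖)
    {μ ν : Measure (Param d)} (h : IsCoupled R δ μ ν) :
    renyiDiff α (runBatches f R η σ b D l μ) (runBatches f R η σ b D l ν)
      ≤ ((α * (c ^ l.length * δ) ^ 2 / (2 * (2 * η * σ ^ 2)) : ℝ) : EReal) := by
  have key : ∀ {μ ν : Measure (Param d)}, IsCoupled R δ μ ν →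
      renyiDiv α (runBatches f R η σ b D l μ) (runBatches f R η σ b D l ν)
        ≤ ((α * (c ^ l.length * δ) ^ 2 / (2 * (2 * η * σ ^ 2)) : ℝ) : EReal) := by
    intro μ ν h
    obtain rfl | ⟨l', β, rfl⟩ := l.eq_nil_or_concat'
    · exact absurd rfl hl
    -- The iterations before the last are coupled; the last contributes its contraction through the
    -- drift and its noise through the Gaussian bound.
    · rw [runBatches_append, runBatches_append]
      refine (h.run_of_eq (σ := σ) hc hR fun β' hβ' =>
        hdrift β' (List.mem_append_left _ hβ')).renyiDiv_step_le hα hη hσ ?_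
      intro x hx y hy hxy
      refine (hdrift β (by simp) x hx y hy).trans ?_
      rw [List.length_append, List.length_singleton, pow_succ', mul_assoc]
      exact mul_le_mul_of_nonneg_left hxy hc
  exact max_le (key h) (key h.symm)

end Run

/-! ### Degenerate cases and the numerical comparison -/

theorem renyiDiff_self {E : Type*} [MeasurableSpace E] {α : ℝ} (hα : 1 < α) (μ : Measure E)
    [IsProbabilityMeasure μ] : renyiDiff α μ μ ≤ ((0 : ℝ) : EReal) := by
  have : renyiDiv α μ μ ≤ ((0 : ℝ) : EReal) := by
    refine renyiDiv_le_of_lintegral_le hα Measure.AbsolutelyContinuous.rfl ?_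
    have h1 : ∀ᵐ x ∂μ, (μ.rnDeriv μ x) ^ α = 1 := by
      filter_upwards [Measure.rnDeriv_self μ] with x hx
      rw [hx, ENNReal.one_rpow]
    rw [lintegral_congr_ae h1]
    simp
  exact max_le this this

theorem eq_of_subsingleton {E : Type*} [MeasurableSpace E] [Subsingleton E] (μ ν : Measure E)
    [IsProbabilityMeasure μ] [IsProbabilityMeasure ν] : μ = ν := by
  ext s _
  rcases s.eq_empty_or_nonempty with rfl | hs
  · simp
  · rw [hs.eq_univ, measure_univ, measure_univ]

/-- Here `w = 2ησ²`. The coupling bound is at most `α/w (p + Q)`; the target has twice that, times a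
prefactor which is at least `1`. -/
theorem renyi_bound_le {α w X p Q : ℝ} (hα : 1 < α) (hw : 0 < w)
    (hX : X ^ 2 ≤ 2 * (p + Q)) (hpQ : 0 ≤ p + Q) :
    α * X ^ 2 / (2 * w)
      ≤ (α - 1 / 2) / (α - 1) * (2 * α / w * p + 2 * α / w * Q) := by
  have hα1 : 0 < α - 1 := by linarith
  have h1 : 1 ≤ (α - 1 / 2) / (α - 1) := by rw [one_le_div hα1]; linarith
  have h2 : 0 ≤ α / w * (p + Q) := by positivity
  calc α * X ^ 2 / (2 * w) = α / (2 * w) * X ^ 2 := by ring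
    _ ≤ α / (2 * w) * (2 * (p + Q)) := mul_le_mul_of_nonneg_left hX (by positivity)
    _ = α / w * (p + Q) := by field_simp
    _ ≤ 1 * (2 * (α / w * (p + Q))) := by linarith
    _ ≤ (α - 1 / 2) / (α - 1) * (2 * (α / w * (p + Q))) :=
        mul_le_mul_of_nonneg_right h1 (by linarith)
    _ = _ := by ring

end SGLU

/-! ### Assembly of the unlearning bound -/

theorem theorem3p2 {𝒳 : Type*} {d n b : ℕ} (hb : 0 < b) (hbn : b ∣ n)
    (f : SGLU.Param d → 𝒳 → ℝ) (R L M m η σ : ℝ)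
    (hR : 0 < R) (hL : 0 < L) (hm : 0 < m) (hη : 0 < η) (hσ : 0 < σ)
    (hsmooth : ∀ z : 𝒳, SGLU.SmoothOn L (Metric.closedBall 0 R) (fun x => f x z))
    (hlip : ∀ z : 𝒳, SGLU.LipschitzOn M (Metric.closedBall 0 R) (fun x => f x z))
    (hconv : ∀ z : 𝒳, SGLU.StronglyConvexOn m (Metric.closedBall 0 R) (fun x => f x z))
    (hηL : η ≤ 1 / L)
    (ν₀ : Measure (SGLU.Param d)) [IsProbabilityMeasure ν₀]
    (hν₀ : ∀ᵐ x ∂ν₀, x ∈ Metric.closedBall (0 : SGLU.Param d) R)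
    (B : SGLU.MiniBatches n b) (T K : ℕ) (hT : 1 ≤ T) (hK : 1 ≤ K)
    (α : ℝ) (hα : 1 < α) :
    let c : ℝ := 1 - η * m
    let Z : ℝ := 2 * R * c ^ (T * (n / b)) +
      min ((1 - c ^ (T * (n / b))) / (1 - c ^ (n / b)) * (2 * η * M / b)) (2 * R)
    let ε₁ : ℝ → ℝ := fun a => a * (2 * R) ^ 2 / (2 * η * σ ^ 2) * c ^ (2 * (T * (n / b)))
    let ε₂ : ℝ → ℝ := fun a => a * Z ^ 2 / (2 * η * σ ^ 2) * c ^ (2 * (K * (n / b)))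
    SGLU.RenyiUnlearning (SGLU.learn f R η σ B ν₀ T) (SGLU.unlearn f R η σ B K) α
      ((α - 1 / 2) / (α - 1) * (ε₁ (2 * α) + ε₂ (2 * α))) := by
  intro c Z ε₁ ε₂ D D' hDD'
  obtain ⟨i, hi⟩ := hDD'
  have hn : 0 < n := i.pos
  have hnb : n / b ≠ 0 := (Nat.div_pos (Nat.le_of_dvd hn hbn) hb).ne'
  have hw : 0 < 2 * η * σ ^ 2 := by positivity
  have hin₀ : SGLU.InBall R ν₀ := ⟨inferInstance, hν₀⟩
  simp only [SGLU.learn, SGLU.unlearn, SGLU.bind_pnsgdKernel]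
  set run := fun (D : Fin n → 𝒳) (t : ℕ) (μ : Measure (SGLU.Param d)) =>
    SGLU.runBatches f R η σ b D (B.epochs t) μ with hrun
  have hrun_add : ∀ D s t μ, run D (s + t) μ = run D t (run D s μ) := fun D s t μ => by
    simp only [hrun, B.epochs_add, SGLU.runBatches_append]
  have hin : ∀ D t {μ}, SGLU.InBall R μ → SGLU.InBall R (run D t μ) := fun D t μ h =>
    h.run hR D _
  change SGLU.renyiDiff α (run D' K (run D T ν₀)) (run D' T ν₀) ≤ _
  set A := c ^ (T * (n / b)) with hA
  set C := c ^ (K * (n / b)) with hC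
  have hε : (α - 1 / 2) / (α - 1) * (ε₁ (2 * α) + ε₂ (2 * α))
      = (α - 1 / 2) / (α - 1) * (2 * α / (2 * η * σ ^ 2) * (2 * R * A) ^ 2
        + 2 * α / (2 * η * σ ^ 2) * (Z * C) ^ 2) := by
    simp only [ε₁, ε₂, hA, hC, mul_comm 2 (_ * (n / b)), pow_mul _ _ 2]
    ring
  rw [hε]
  have hpQ : 0 ≤ (2 * R * A) ^ 2 + (Z * C) ^ 2 := by positivity
  rcases Nat.eq_zero_or_pos d with rfl | hd
  -- In dimension `0` the hypotheses force neither `M ≥ 0` nor `c ≥ 0`, but all probability measures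
  -- coincide.
  · have h1 := (hin D' K (hin D T hin₀)).1
    have h2 := (hin D' T hin₀).1
    rw [SGLU.eq_of_subsingleton (run D' K (run D T ν₀)) (run D' T ν₀)]
    refine (SGLU.renyiDiff_self hα _).trans (EReal.coe_le_coe_iff.2 ?_)
    simpa using SGLU.renyi_bound_le (X := 0) hα hw (by linarith) hpQ
  have : NeZero d := ⟨hd.ne'⟩
  have hM : 0 ≤ M := (hlip (D i)).nonneg hR
  have hηL' : η * L ≤ 1 := by rwa [le_div_iff₀ hL] at hηL
  have hηm : η * m ≤ η * L :=
    mul_le_mul_of_nonneg_left ((hconv (D i)).le_of_smoothOn hR (hsmooth (D i))) hη.le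
  have hc0 : 0 ≤ c := by simp only [c]; linarith
  have hc1 : c < 1 := by
    have : 0 < η * m := by positivity
    simp only [c]
    linarith
  have hA0 : 0 ≤ A := pow_nonneg hc0 _
  have hC0 : 0 ≤ C := pow_nonneg hc0 _
  have he : 0 ≤ 2 * η * M / b := by positivity
  have hsame : ∀ β : Finset (Fin n), β.card = b →
      ∀ x ∈ Metric.closedBall (0 : SGLU.Param d) R, ∀ y ∈ Metric.closedBall (0 : SGLU.Param d) R,
      ‖(x - η • SGLU.batchGrad f b D' β x) - (y - η • SGLU.batchGrad f b D' β y)‖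
        ≤ c * ‖x - y‖ := fun β hβ x hx y hy =>
    SGLU.norm_batchStep_sub_le hb hR hL hη hηL hc0 hsmooth hconv D' hβ hx hy
  have hdiff : ∀ β : Finset (Fin n), β.card = b →
      ∀ x ∈ Metric.closedBall (0 : SGLU.Param d) R, ∀ y ∈ Metric.closedBall (0 : SGLU.Param d) R,
      ‖(x - η • SGLU.batchGrad f b D β x) - (y - η • SGLU.batchGrad f b D' β y)‖
        ≤ c * ‖x - y‖ + if i ∈ β then 2 * η * M / b else 0 := fun β hβ x hx y hy => by
    rw [← sub_add_sub_cancel _ (x - η • SGLU.batchGrad f b D' β x), add_comm]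
    exact (norm_add_le _ _).trans (add_le_add (hsame β hβ x hx y hy)
      (SGLU.norm_batchStep_sub_batchStep_le hR hM hη hsmooth hlip hi β hx))
  have hdiv : ∀ {t : ℕ} {δ : ℝ} {μ ν : Measure (SGLU.Param d)}, 1 ≤ t →
      SGLU.IsCoupled R δ μ ν → SGLU.renyiDiff α (run D' t μ) (run D' t ν)
        ≤ ((α * (c ^ (t * (n / b)) * δ) ^ 2 / (2 * (2 * η * σ ^ 2)) : ℝ) : EReal) := by
    intro t δ μ ν ht h
    rw [← B.length_epochs t]
    refine h.renyiDiff_run_le hα hη hσ hc0 hR ?_ fun β hβ => hsame β (B.card_of_mem_epochs hβ)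
    rw [← List.length_pos_iff_ne_nil, B.length_epochs]
    exact Nat.mul_pos ht (Nat.pos_of_ne_zero hnb)
  rcases le_total T K with hTK | hKT
  -- Unlearning ends with `T` epochs on `D'`, as does retraining; whatever precedes them stays in
  -- the ball.
  · have h := hdiv hT ((hin D' (K - T) (hin D T hin₀)).isCoupled hin₀)
    rw [← hrun_add, Nat.sub_add_cancel hTK, ← hA] at h
    refine h.trans (EReal.coe_le_coe_iff.2 (SGLU.renyi_bound_le hα hw ?_ hpQ))
    nlinarith [sq_nonneg (2 * R * A), sq_nonneg (Z * C)]
  -- Learning on `D` is cut after `K` epochs, so that its other `T - K` epochs face the first `T -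
  -- K` epochs of retraining.
  · have hcpl := (SGLU.IsCoupled.run_epochs (σ := σ) hc0 hc1 he hR hnb B hdiff
      ((hin D K hin₀).isCoupled hin₀) (T - K)).min_two_mul
    have h := hdiv hK hcpl
    change SGLU.renyiDiff α (run D' K (run D (T - K) (run D K ν₀)))
      (run D' K (run D' (T - K) ν₀)) ≤ _ at h
    rw [← hrun_add D, ← hrun_add D', Nat.add_sub_cancel' hKT, Nat.sub_add_cancel hKT, ← hC] at h
    refine h.trans (EReal.coe_le_coe_iff.2 (SGLU.renyi_bound_le hα hw ?_ hpQ))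
    set q := c ^ ((T - K) * (n / b)) with hq
    set e := 2 * η * M / b
    have hq0 : 0 ≤ q := pow_nonneg hc0 _
    have hCq : C * q = A := by
      rw [hC, hq, hA, ← pow_add, ← add_mul, Nat.add_sub_cancel' hKT]
    have hden : 0 < 1 - c ^ (n / b) := by linarith [pow_lt_one₀ hc0 hc1 hnb]
    have hq1 : q ≤ 1 := pow_le_one₀ hc0 hc1.le
    have hC1 : C ≤ 1 := pow_le_one₀ hc0 hc1.le
    have hAq : A ≤ q := by rw [← hCq]; exact mul_le_of_le_one_left hq0 hC1
    -- The error of `T - K` epochs is at most that of `T` epochs, the one appearing in `Z`.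
    have hgeom : (1 - q) / (1 - c ^ (n / b)) * e ≤ (1 - A) / (1 - c ^ (n / b)) * e := by
      gcongr
    have hgeom0 : 0 ≤ (1 - q) / (1 - c ^ (n / b)) * e :=
      mul_nonneg (div_nonneg (by linarith) hden.le) he
    have hmin : min (q * (2 * R) + (1 - q) / (1 - c ^ (n / b)) * e) (2 * R)
        ≤ 2 * R * q + min ((1 - A) / (1 - c ^ (n / b)) * e) (2 * R) := by
      rw [← min_add_add_left]
      refine min_le_min (by linarith) ?_
      have : 0 ≤ 2 * R * q := by positivity
      linarith
    have hmin0 : 0 ≤ min (q * (2 * R) + (1 - q) / (1 - c ^ (n / b)) * e) (2 * R) :=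
      le_min (by positivity) (by positivity)
    have hZ : min ((1 - A) / (1 - c ^ (n / b)) * e) (2 * R) ≤ Z := by
      have : 0 ≤ 2 * R * A := by positivity
      simp only [Z]
      linarith
    have hX : C * min (q * (2 * R) + (1 - q) / (1 - c ^ (n / b)) * e) (2 * R)
        ≤ 2 * R * A + Z * C := by
      calc _ ≤ C * (2 * R * q + Z) := mul_le_mul_of_nonneg_left (by linarith) hC0
        _ = _ := by rw [← hCq]; ring
    refine (pow_le_pow_left₀ (mul_nonneg hC0 hmin0) hX 2).trans ?_
    nlinarith [sq_nonneg (2 * R * A - Z * C)]
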